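/- **Setting.** Let $D\ge 1$, $p\in(0,1)$, and let $\mathcal P_+,\mathcal P_-$ be probability distributions on $\mathbb R^D$ (Euclidean norm). Write $\mathcal X_+$ for the support of $\mathcal P_+$. A labelled example is positive with probability $p$, its position then being drawn from $\mathcal P_+$, and negative with probability $1-p$, its position then being drawn from $\mathcal P_-$; the dataset $X$ consists of $n$ i.i.d. examples, whose labels are hidden until queried. The *offline learner* with initial sample size $m\le n$ draws $m$ of the examples uniformly at random without replacement (the initial sample $X_0$) and queries their labels; it then queries the remaining examples in ascending order of the distance to the set $X_{0,+}$ of the positive examples of $X_0$ (ties broken by index; if $X_{0,+}=\emptyset$, all distances are equal), until all positive examples have been queried. If $Q$ is the total number of its queries and $Q_{\rm opt}$ the number of examples of $X$ that lie in $\mathcal X_+$, its excess query cost is $C_{\rm offline}=Q-Q_{\rm opt}$. Write $\mathbb E[C_{\rm offline}\mid X_0]$ for the conditional expectation given the labelled initial sample. **Assumptions.** (A1) The above mixture model with $0<p<1$. (A2) $\mathcal P_+$ has a density $f_+$ whose support $\mathcal X_+$ is compact with finitely many connected components, and there are $\lambda_0,r_0,C_+>0$ with $f_+\ge\lambda_0$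 on $\mathcal X_+$ and $\mathrm{Vol}(B(x,r)\cap \mathcal X_+)\ge C_+\mathrm{Vol}(B(x,r))$ for all $x\in\mathcal X_+$ and $0<r<r_0$. (A3) $\mathcal P_-$ has a density bounded by some $\lambda_1>0$. **Theorem.** Let $D\ge1$ and $p\in(0,1)$. (1) There are distributions $\mathcal P_+,\mathcal P_-$ on $\mathbb R^D$ satisfying (A1)–(A3) such that for every $\theta<1$ there are $C>0$ and $N$ such that for all $n\ge N$ and all $m$ with $N\le m\le\theta n$, with probability at least $\tfrac14$ over the initial sample, $$\mathbb E[C_{\rm offline}\mid X_0]\ \ge\ (1-p)\,m+C\Big(\frac{\log m}{m}\Big)^{1/D} n .$$ (2) The uniform distributions $\mathcal P_+$ on $[0,1]^D$ and $\mathcal P_-$ on $[-1,2]^D$ satisfy (A1)–(A3), and for them there are $C,c>0$ and $N$ such that the same bound holds with probability at least $\tfrac14$ over the initial sample for all $n\ge N$ and all $m$ with $N\le m\le n$ and $m\le c\,(\log m/m)^{1/D}\,n$ (for every constant $K$ this includes all sufficiently large $m\le K n^{D/(D+1)}$). -/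

import Mathlib

open MeasureTheory ProbabilityTheory

noncomputable section

namespace ActiveCovering

/-- Euclidean space `ℝ^D`. -/
abbrev Pt (D : ℕ) : Type := EuclideanSpace ℝ (Fin D)

/-- The cube `[a, b]^D`. -/
def cube (D : ℕ) (a b : ℝ) : Set (Pt D) := {x | ∀ i, a ≤ x i ∧ x i ≤ b}

/-- The uniform distribution on a subset of `ℝ^D`: normalized Lebesgue measure on the set. -/
def uniformDist {D : ℕ} (s : Set (Pt D)) : Measure (Pt D) := ProbabilityTheory.cond volume s

/-- `f` is a (nonnegative, measurable) Lebesgue density of `P`. -/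
def IsDensity {D : ℕ} (f : Pt D → ℝ) (P : Measure (Pt D)) : Prop :=
  Measurable f ∧ (∀ x, 0 ≤ f x) ∧ P = volume.withDensity (fun x => ENNReal.ofReal (f x))

/-- The law of one labelled example `(x, y)`: with probability `p` the label is positive (`true`)
and `x` is drawn from `Pp`; with probability `1 - p` the label is negative (`false`) and `x` is
drawn from `Pm`. The law of `x` is the mixture `p Pp + (1 - p) Pm`. -/
def labelledLaw {D : ℕ} (p : ℝ) (Pp Pm : Measure (Pt D)) : Measure (Pt D × Bool) :=
  ENNReal.ofReal p • Pp.map (fun x => (x, true)) +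
    ENNReal.ofReal (1 - p) • Pm.map (fun x => (x, false))

/-- The data are generated by a proper mixture of two probability distributions. -/
def MixtureAssumption {D : ℕ} (p : ℝ) (Pp Pm : Measure (Pt D)) : Prop :=
  0 < p ∧ p < 1 ∧ IsProbabilityMeasure Pp ∧ IsProbabilityMeasure Pm

/-- The positive examples have a density with compact support with finitely many connected
components; the density is bounded below on its support, and the support is nowhere thin. -/
def PositiveAssumption {D : ℕ} (Pp : Measure (Pt D)) : Prop :=
  ∃ f : Pt D → ℝ, IsDensity f Pp ∧ tsupport f = Pp.support ∧ IsCompact Pp.support ∧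
    Finite (ConnectedComponents Pp.support) ∧
    ∃ lam r₀ c : ℝ, 0 < lam ∧ 0 < r₀ ∧ 0 < c ∧
      (∀ x ∈ Pp.support, lam ≤ f x) ∧
      ∀ r : ℝ, 0 < r → r < r₀ → ∀ x ∈ Pp.support,
        ENNReal.ofReal c * volume (Metric.closedBall x r) ≤
          volume (Metric.closedBall x r ∩ Pp.support)

/-- The negative examples have a bounded density. -/
def NegativeAssumption {D : ℕ} (Pm : Measure (Pt D)) : Prop :=
  ∃ f : Pt D → ℝ, IsDensity f Pm ∧ ∃ lam : ℝ, 0 < lam ∧ ∀ x, f x ≤ lam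

/-- All the distributional assumptions together. -/
def Assumptions {D : ℕ} (p : ℝ) (Pp Pm : Measure (Pt D)) : Prop :=
  MixtureAssumption p Pp Pm ∧ PositiveAssumption Pp ∧ NegativeAssumption Pm

/-- An outcome: the set of indices of the initial sample, and the labelled dataset of size `n`. -/
abbrev Outcome (D n : ℕ) : Type := Finset (Fin n) × (Fin n → Pt D × Bool)

/-- The law of an outcome: the `n` labelled examples are i.i.d., and independently the initial
sample is a uniformly random subset of `m` indices (sampling without replacement). -/
def outcomeLaw {D : ℕ} (p : ℝ) (Pp Pm : Measure (Pt D)) (n m : ℕ) : Measure (Outcome D n) :=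
  (uniformOn {S : Finset (Fin n) | S.card = m}).prod
    (Measure.pi fun _ => labelledLaw p Pp Pm)

/-- The positions of the positive examples in the initial sample. -/
def initialPositives {D n : ℕ} (ω : Outcome D n) : Set (Pt D) :=
  {x | ∃ i ∈ ω.1, (ω.2 i).2 = true ∧ (ω.2 i).1 = x}

/-- Distance of the `i`-th example to the initial positive examples
(infinite if there are none). -/
def distToPositives {D n : ℕ} (ω : Outcome D n) (i : Fin n) : ENNReal :=
  Metric.infEDist (ω.2 i).1 (initialPositives ω)

/-- After the initial sample, the example `j` is label queried no later than the example `i`: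
the order is by ascending distance to the initial positives, ties being broken by index. -/
def QueriedUpTo {D n : ℕ} (ω : Outcome D n) (j i : Fin n) : Prop :=
  distToPositives ω j < distToPositives ω i ∨
    (distToPositives ω j = distToPositives ω i ∧ j ≤ i)

open Classical in
/-- The examples which the offline learner label queries: the initial sample, and then the
remaining ones in order until the last remaining positive example is label queried. -/
def queried {D n : ℕ} (ω : Outcome D n) : Finset (Fin n) :=
  Finset.univ.filter fun j =>
    j ∈ ω.1 ∨ ∃ i, i ∉ ω.1 ∧ (ω.2 i).2 = true ∧ QueriedUpTo ω j i

open Classical in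
/-- The examples which the optimal learner label queries: those in the support of the
positive distribution. -/
def optimalQueried {D n : ℕ} (Pp : Measure (Pt D)) (ω : Outcome D n) : Finset (Fin n) :=
  Finset.univ.filter fun j => (ω.2 j).1 ∈ Pp.support

/-- The excess query cost of the offline learner. -/
def excessCost {D n : ℕ} (Pp : Measure (Pt D)) (ω : Outcome D n) : ℝ :=
  ((queried ω).card : ℝ) - ((optimalQueried Pp ω).card : ℝ)

open Classical in
/-- What is seen in the initial phase: the initial indices, with the positions and labels of the
examples they index (a dummy value stands at all other indices). -/
def initialData {D n : ℕ} (ω : Outcome D n) : Outcome D n :=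
  (ω.1, fun i => if i ∈ ω.1 then ω.2 i else (0, false))

/-- The conditional expectation of the excess query cost of the offline learner, given the
labelled initial sample. -/
def expectedExcessCost {D : ℕ} (p : ℝ) (Pp Pm : Measure (Pt D)) (n m : ℕ) : Outcome D n → ℝ :=
  condExp (MeasurableSpace.comap (initialData (D := D) (n := n)) inferInstance)
    (outcomeLaw p Pp Pm n m) (excessCost Pp)

/-- The rate `(log m / m)^{1/D}`. -/
def rate (D m : ℕ) : ℝ := (Real.log m / m) ^ (1 / (D : ℝ))

/-- With probability at least `1/4` over the initial sample, the expected excess query cost is at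
least `(1 - p) m + C (log m / m)^{1/D} n`. -/
def LowerBoundHolds {D : ℕ} (p : ℝ) (Pp Pm : Measure (Pt D)) (C : ℝ) (n m : ℕ) : Prop :=
  1 / 4 ≤ (outcomeLaw p Pp Pm n m).real
    {ω | (1 - p) * m + C * rate D m * n ≤ expectedExcessCost p Pp Pm n m ω}

end ActiveCovering

end

/-! The learner has to reach the last positive example, and on the way it queries everything closer
to the initial positives. Cut the unit cube into cells of width `1 / k` and volume of order `log m /
m`. The expected number of cells without an initial positive is at least `m ^ (1/4)`, and emptiness
of distinct cells is negatively correlated, so a second moment bound makes an empty cell very likely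
(`measureReal_forall_not_avoiding_le`). The middle third of such a cell is at distance at least `1 /
(3 k)` from every initial positive, and with probability at least one half some remaining example is
a positive there. On the finer grid of width `1 / (7 D k)`, at least half of the cells along one
face are very likely occupied, and their mirror images outside the cube are within `2 / (7 k) < 1 /
(3 k)` of an initial positive. These images have total volume at least `1 / (14 D k)`, of order
`rate D m`, and all examples in them are queried before the far positive. This costs order `rate D m
* n` in expectation (`measureReal_integral_excessCost_lt_le`).

The excess cost consists of the initial examples outside the support, plus the later queries outside
it, minus the unqueried examples inside it (`excessCost_eq`). The last term has bounded expectation: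
an unqueried example in the support comes after all remaining positives, so giving it a positive
label makes it the last positive, and there is at most one of those. The price of the change is the
ratio `κ` of negative to positive mass in the support (`sum_measure_notMem_queried_le`).

In (1) the negatives are uniform on `[-1,2]^D` minus `[0,1]^D`. Then `κ = 0`, and the first term is
binomial with mean `(1 - p) m`, which by the central limit theorem is attained with probability at
least `3/8`; the failure probability `1/8` of the geometric part leaves `1/4`. In (2) the
restriction on `m` lets a fraction of `C * rate D m * n` absorb both `(1 - p) m` and `κ`.

Conditioning on the initial sample amounts to averaging over fresh independent copies of the
remaining examples (`condExp_initialData_ae_eq`), so everything can be proved for a fixed index set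
`S`. -/

open scoped ENNReal

namespace ActiveCovering

/-! ### Product measures: resampling some of the coordinates -/

section Product

variable {ι E : Type*}

open Classical in
/-- The family which agrees with `x` on `S` and with `y` off `S`. -/
noncomputable def merge (S : Finset ι) (x y : ι → E) : ι → E := fun i => if i ∈ S then x i else y i

theorem merge_of_mem {S : Finset ι} {x y : ι → E} {i : ι} (h : i ∈ S) : merge S x y i = x i :=
  if_pos h

theorem merge_of_notMem {S : Finset ι} {x y : ι → E} {i : ι} (h : i ∉ S) :
    merge S x y i = y i :=
  if_neg h

variable [MeasurableSpace E]

theorem measurable_merge (S : Finset ι) :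
    Measurable fun q : (ι → E) × (ι → E) => merge S q.1 q.2 := by
  refine measurable_pi_lambda _ fun i => ?_
  by_cases h : i ∈ S
  · simp only [merge_of_mem h]; fun_prop
  · simp only [merge_of_notMem h]; fun_prop

variable [Fintype ι] (μ : Measure E) [IsProbabilityMeasure μ]

/-- The preimage of a box is a product of two boxes, one constraining only the coordinates in `S`,
the other only those off `S`. The measures multiply to that of the original box. -/
theorem measurePreserving_merge (S : Finset ι) :
    MeasurePreserving (fun q : (ι → E) × (ι → E) => merge S q.1 q.2)
      ((Measure.pi fun _ => μ).prod (Measure.pi fun _ => μ)) (Measure.pi fun _ => μ) := by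
  classical
  refine ⟨measurable_merge S, (Measure.pi_eq fun s hs => ?_).symm⟩
  rw [Measure.map_apply (measurable_merge S) (MeasurableSet.univ_pi hs)]
  have : (fun q : (ι → E) × (ι → E) => merge S q.1 q.2) ⁻¹' Set.univ.pi s =
      (Set.univ.pi fun i => if i ∈ S then s i else Set.univ) ×ˢ
        (Set.univ.pi fun i => if i ∈ S then Set.univ else s i) := by
    ext ⟨x, y⟩
    simp only [Set.mem_preimage, Set.mem_pi, Set.mem_univ, true_imp_iff, Set.mem_prod,
      ← forall_and]
    refine forall_congr' fun i => ?_
    by_cases h : i ∈ S <;> simp [merge, h]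
  rw [this, Measure.prod_prod, Measure.pi_pi, Measure.pi_pi, ← Finset.prod_mul_distrib]
  refine Finset.prod_congr rfl fun i _ => ?_
  by_cases h : i ∈ S <;> simp [h]

/-- Fubini in a single coordinate: merge along `{j}` and integrate out the family that supplies the
`j`-th entry. -/
theorem measure_pi_eq_lintegral_update [DecidableEq ι] (j : ι) {A : Set (ι → E)}
    (hA : MeasurableSet A) :
    Measure.pi (fun _ => μ) A =
      ∫⁻ x, μ {y | Function.update x j y ∈ A} ∂Measure.pi fun _ => μ := by
  have hm : MeasurePreserving (fun q : (ι → E) × (ι → E) => merge {j} q.1 q.2)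
      ((Measure.pi fun _ => μ).prod (Measure.pi fun _ => μ)) (Measure.pi fun _ => μ) :=
    measurePreserving_merge μ {j}
  rw [← hm.measure_preimage hA.nullMeasurableSet, Measure.prod_apply_symm (hm.measurable hA)]
  refine lintegral_congr fun x => ?_
  rw [← (measurePreserving_eval (fun _ => μ) j).measure_preimage]
  · congr 1
    ext y
    have : merge {j} y x = Function.update x j (y j) := by
      ext i
      by_cases h : i = j
      · subst h; simp [merge]
      · simp [merge, h]
    simp [this]
  · exact (measurable_update x hA).nullMeasurableSet

/-- Comparison of two events which differ only in the `j`-th coordinate. -/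
theorem measure_pi_le_mul_of_update [DecidableEq ι] (j : ι) {A B : Set (ι → E)}
    (hA : MeasurableSet A) (hB : MeasurableSet B) (c : ℝ≥0∞)
    (h : ∀ x, μ {y | Function.update x j y ∈ A} ≤ c * μ {y | Function.update x j y ∈ B}) :
    Measure.pi (fun _ => μ) A ≤ c * Measure.pi (fun _ => μ) B := by
  rw [measure_pi_eq_lintegral_update μ j hA, measure_pi_eq_lintegral_update μ j hB,
    ← lintegral_const_mul]
  · refine lintegral_mono fun x => ?_
    exact h x
  · have : Measurable fun q : (ι → E) × E => Function.update q.1 j q.2 := by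
      refine measurable_pi_lambda _ fun i => ?_
      by_cases h : i = j
      · subst h; simpa using measurable_snd
      · simp only [Function.update_of_ne h]; fun_prop
    exact measurable_measure_prodMk_left (ν := μ) (this hB)

theorem measure_pi_finset_pi (S : Finset ι) (s : ι → Set E) :
    Measure.pi (fun _ => μ) {x | ∀ i ∈ S, x i ∈ s i} = ∏ i ∈ S, μ (s i) := by
  classical
  have : {x : ι → E | ∀ i ∈ S, x i ∈ s i} =
      Set.univ.pi fun i => if i ∈ S then s i else Set.univ := by
    ext x
    simp only [Set.mem_ofPred_eq, Set.mem_pi, Set.mem_univ, true_imp_iff]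
    refine forall_congr' fun i => ?_
    by_cases h : i ∈ S <;> simp [h]
  rw [this, Measure.pi_pi, ← Finset.prod_subset (Finset.subset_univ S)]
  · exact Finset.prod_congr rfl fun i hi => by simp [hi]
  · intro i _ hi
    simp [hi]

end Product

/-! ### Conditional expectation given the initial sample -/

section Conditional

variable {D n : ℕ}

theorem measurable_initialData : Measurable (initialData (D := D) (n := n)) := by
  refine measurable_fst.prodMk (measurable_pi_lambda _ fun i => ?_)
  refine Measurable.ite ?_ ((measurable_pi_apply i).comp measurable_snd) measurable_const
  exact measurable_fst (measurableSet_mem_finset i)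

theorem merge_initialData (ω : Outcome D n) (y : Fin n → Pt D × Bool) :
    merge ω.1 (initialData ω).2 y = merge ω.1 ω.2 y := by
  ext1 i
  by_cases h : i ∈ ω.1
  · rw [merge_of_mem h, merge_of_mem h]; simp [initialData, h]
  · rw [merge_of_notMem h, merge_of_notMem h]

theorem initialData_merge (ω : Outcome D n) (y : Fin n → Pt D × Bool) :
    initialData (ω.1, merge ω.1 ω.2 y) = initialData ω := by
  ext1
  · rfl
  · ext1 i
    by_cases h : i ∈ ω.1
    · simp [initialData, h, merge_of_mem h]
    · simp [initialData, h]

/-- The labelled examples outside the initial sample replaced by `y`. -/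
noncomputable def resample (ω : Outcome D n) (y : Fin n → Pt D × Bool) : Outcome D n :=
  (ω.1, merge ω.1 ω.2 y)

theorem measurable_merge_uncurry :
    Measurable fun q : Finset (Fin n) × ((Fin n → Pt D × Bool) × (Fin n → Pt D × Bool)) =>
      merge q.1 q.2.1 q.2.2 :=
  measurable_from_prod_countable_right fun S => measurable_merge S

theorem measurable_resample :
    Measurable fun q : Outcome D n × (Fin n → Pt D × Bool) => resample q.1 q.2 :=
  (measurable_fst.comp measurable_fst).prodMk
    (measurable_merge_uncurry.comp
      ((measurable_fst.comp measurable_fst).prodMk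
        ((measurable_snd.comp measurable_fst).prodMk measurable_snd)))

variable (p : ℝ) (Pp Pm : Measure (Pt D)) (n)

theorem measurePreserving_resample [IsProbabilityMeasure (labelledLaw p Pp Pm)] (m : ℕ) :
    MeasurePreserving (fun q : Outcome D n × (Fin n → Pt D × Bool) => resample q.1 q.2)
      ((outcomeLaw p Pp Pm n m).prod (Measure.pi fun _ => labelledLaw p Pp Pm))
      (outcomeLaw p Pp Pm n m) := by
  have h := MeasurePreserving.skew_product
    (MeasurePreserving.id (uniformOn {S : Finset (Fin n) | S.card = m}))
    (g := fun S (q : (Fin n → Pt D × Bool) × (Fin n → Pt D × Bool)) => merge S q.1 q.2)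
    (μc := (Measure.pi fun _ => labelledLaw p Pp Pm).prod
      (Measure.pi fun _ => labelledLaw p Pp Pm))
    (μd := Measure.pi fun _ => labelledLaw p Pp Pm)
    measurable_merge_uncurry
    (Filter.Eventually.of_forall fun S => (measurePreserving_merge _ S).map_eq)
  exact h.comp (measurePreserving_prodAssoc _ _ _)

variable {n}

/-- The examples off the initial sample are independent of the initial data. Resampling them
preserves the law of the outcome and leaves every event generated by `initialData` unchanged, which
gives the defining integral identity. -/
theorem condExp_initialData_ae_eq [IsProbabilityMeasure (labelledLaw p Pp Pm)] {m : ℕ}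
    (hm : m ≤ n) {f : Outcome D n → ℝ} (hf : Measurable f) {b : ℝ} (hb : ∀ ω, |f ω| ≤ b) :
    condExp (MeasurableSpace.comap (initialData (D := D) (n := n)) inferInstance)
      (outcomeLaw p Pp Pm n m) f =ᵐ[outcomeLaw p Pp Pm n m]
    fun ω => ∫ y, f (resample ω y) ∂Measure.pi fun _ => labelledLaw p Pp Pm := by
  have hne : {S : Finset (Fin n) | S.card = m}.Nonempty := by
    obtain ⟨S, -, hS⟩ := Finset.exists_subset_card_eq (s := (Finset.univ : Finset (Fin n)))
      (n := m) (by simpa using hm)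
    exact ⟨S, hS⟩
  have hprob : IsProbabilityMeasure (uniformOn {S : Finset (Fin n) | S.card = m}) :=
    isProbabilityMeasure_uniformOn (Set.toFinite _) hne
  have : IsProbabilityMeasure (outcomeLaw p Pp Pm n m) := by
    unfold outcomeLaw; infer_instance
  have hint : ∀ {Ω : Type} [MeasurableSpace Ω] (P : Measure Ω) [IsProbabilityMeasure P]
      {g : Ω → ℝ}, Measurable g → (∀ ω, |g ω| ≤ b) → Integrable g P := fun P _ g hg hgb =>
    Integrable.of_bound hg.aestronglyMeasurable b (Filter.Eventually.of_forall hgb)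
  have hF : StronglyMeasurable fun ω : Outcome D n =>
      ∫ y, f (resample ω y) ∂Measure.pi fun _ => labelledLaw p Pp Pm :=
    ((hf.comp measurable_resample).stronglyMeasurable (β := ℝ)).integral_prod_right'
  have hFb : ∀ ω : Outcome D n,
      |∫ y, f (resample ω y) ∂Measure.pi fun _ => labelledLaw p Pp Pm| ≤ b := by
    intro ω
    have := norm_integral_le_of_norm_le_const (μ := Measure.pi fun _ => labelledLaw p Pp Pm)
      (f := fun y : Fin n → Pt D × Bool => f (resample ω y))
      (Filter.Eventually.of_forall fun y => hb (resample ω y))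
    simpa using this
  symm
  refine ae_eq_condExp_of_forall_setIntegral_eq measurable_initialData.comap_le
    (hint _ hf hb) (fun s _ _ => (hint _ hF.measurable hFb).integrableOn) ?_ ?_
  · rintro s ⟨t, ht, rfl⟩ -
    have hs : MeasurableSet (initialData (D := D) (n := n) ⁻¹' t) := measurable_initialData ht
    rw [← integral_indicator hs, ← integral_indicator hs]
    have hg : Measurable ((initialData (D := D) (n := n) ⁻¹' t).indicator f) := hf.indicator hs
    have hgb : ∀ ω, |(initialData (D := D) (n := n) ⁻¹' t).indicator f ω| ≤ b := by
      intro ω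
      by_cases h : ω ∈ initialData (D := D) (n := n) ⁻¹' t
      · simpa [h] using hb ω
      · simpa [h] using (abs_nonneg _).trans (hb ω)
    have e : ∫ ω, (initialData (D := D) (n := n) ⁻¹' t).indicator f ω ∂outcomeLaw p Pp Pm n m =
        ∫ q : Outcome D n × (Fin n → Pt D × Bool),
          (initialData (D := D) (n := n) ⁻¹' t).indicator f (resample q.1 q.2)
          ∂(outcomeLaw p Pp Pm n m).prod (Measure.pi fun _ => labelledLaw p Pp Pm) := by
      conv_lhs => rw [← (measurePreserving_resample n p Pp Pm m).map_eq]
      exact integral_map measurable_resample.aemeasurable hg.aestronglyMeasurable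
    rw [e, integral_prod _ (hint _ (g := fun q : Outcome D n × (Fin n → Pt D × Bool) =>
      (initialData (D := D) (n := n) ⁻¹' t).indicator f (resample q.1 q.2))
      (hg.comp measurable_resample) fun q => hgb _)]
    refine integral_congr_ae (Filter.Eventually.of_forall fun ω => ?_)
    have key : ∀ y, resample ω y ∈ initialData (D := D) (n := n) ⁻¹' t ↔
        ω ∈ initialData (D := D) (n := n) ⁻¹' t := fun y => by
      simp only [Set.mem_preimage, resample, initialData_merge]
    by_cases h : ω ∈ initialData (D := D) (n := n) ⁻¹' t
    · simp [Set.indicator, key, h]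
    · simp [Set.indicator, key, h]
  -- The average over fresh examples ignores the old ones, so it factors through `initialData` and
  -- is measurable for the conditioning σ-algebra.
  · have : (fun ω : Outcome D n =>
        ∫ y, f (resample ω y) ∂Measure.pi fun _ => labelledLaw p Pp Pm) =
        (fun ω => ∫ y, f (resample ω y) ∂Measure.pi fun _ => labelledLaw p Pp Pm) ∘
          initialData := by
      ext ω
      have : ∀ y, resample (initialData ω) y = resample ω y := fun y =>
        Prod.ext rfl (merge_initialData ω y)
      simp [this]
    rw [this]
    exact (hF.comp_measurable (comap_measurable initialData)).aestronglyMeasurable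

/-- A bound for the conditional expectation which holds with probability at least `q` for every
set of initial indices holds with probability at least `q`. -/
theorem le_measureReal_outcomeLaw [IsProbabilityMeasure (labelledLaw p Pp Pm)] {m : ℕ}
    (hm : m ≤ n) {f : Outcome D n → ℝ} (hf : Measurable f) {b : ℝ} (hb : ∀ ω, |f ω| ≤ b)
    {a q : ℝ}
    (h : ∀ S : Finset (Fin n), S.card = m →
      q ≤ (Measure.pi fun _ => labelledLaw p Pp Pm).real
        {x | a ≤ ∫ y, f (S, merge S x y) ∂Measure.pi fun _ => labelledLaw p Pp Pm}) :
    q ≤ (outcomeLaw p Pp Pm n m).real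
      {ω | a ≤ condExp (MeasurableSpace.comap (initialData (D := D) (n := n)) inferInstance)
        (outcomeLaw p Pp Pm n m) f ω} := by
  have hne : {S : Finset (Fin n) | S.card = m}.Nonempty := by
    obtain ⟨S, -, hS⟩ := Finset.exists_subset_card_eq (s := (Finset.univ : Finset (Fin n)))
      (n := m) (by simpa using hm)
    exact ⟨S, hS⟩
  have hprob : IsProbabilityMeasure (uniformOn {S : Finset (Fin n) | S.card = m}) :=
    isProbabilityMeasure_uniformOn (Set.toFinite _) hne
  have hF : Measurable fun ω : Outcome D n =>
      ∫ y, f (resample ω y) ∂Measure.pi fun _ => labelledLaw p Pp Pm :=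
    ((hf.comp measurable_resample).stronglyMeasurable (β := ℝ)).integral_prod_right'.measurable
  have hset : MeasurableSet {ω : Outcome D n |
      a ≤ ∫ y, f (resample ω y) ∂Measure.pi fun _ => labelledLaw p Pp Pm} :=
    measurableSet_le measurable_const hF
  have hP : IsProbabilityMeasure (outcomeLaw p Pp Pm n m) := by
    unfold outcomeLaw; infer_instance
  have e : (outcomeLaw p Pp Pm n m)
      {ω | a ≤ condExp (MeasurableSpace.comap (initialData (D := D) (n := n)) inferInstance)
        (outcomeLaw p Pp Pm n m) f ω} = (outcomeLaw p Pp Pm n m) {ω : Outcome D n |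
      a ≤ ∫ y, f (resample ω y) ∂Measure.pi fun _ => labelledLaw p Pp Pm} := by
    refine measure_congr ?_
    filter_upwards [condExp_initialData_ae_eq p Pp Pm hm hf hb] with ω hω
    apply propext
    change a ≤ _ ↔ a ≤ _
    rw [hω]
  rw [measureReal_def, e, ← ENNReal.ofReal_le_iff_le_toReal (measure_ne_top _ _)]
  change _ ≤ ((uniformOn {S : Finset (Fin n) | S.card = m}).prod
    (Measure.pi fun _ => labelledLaw p Pp Pm)) _
  -- By Fubini over the index set, the hypothesis for each `S` of size `m` suffices, as almost every
  -- `S` has that size.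
  rw [Measure.prod_apply hset]
  calc ENNReal.ofReal q = ∫⁻ _, ENNReal.ofReal q
        ∂uniformOn {S : Finset (Fin n) | S.card = m} := by simp
    _ ≤ _ := by
      refine lintegral_mono_ae ?_
      have : ∀ᵐ S ∂uniformOn {S : Finset (Fin n) | S.card = m}, S.card = m :=
        ae_cond_mem (Set.toFinite _).measurableSet
      filter_upwards [this] with S hS
      rw [ENNReal.ofReal_le_iff_le_toReal (measure_ne_top _ _)]
      exact h S hS

end Conditional

/-! ### Binomial counts and the central limit theorem -/

section Count

/-- Negation exchanges the two open half-lines, and with no atom at zero they share the total mass.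
-/
theorem gaussianReal_zero_Ioi {v : NNReal} (hv : v ≠ 0) :
    gaussianReal 0 v (Set.Ioi 0) = 1 / 2 := by
  have hna : NullSingletonClass (gaussianReal 0 v) := nullSingletonClass_gaussianReal hv
  have h1 : gaussianReal 0 v (Set.Iio 0) = gaussianReal 0 v (Set.Ioi 0) := by
    conv_rhs => rw [← neg_zero, ← gaussianReal_map_neg, Measure.map_apply measurable_neg
      measurableSet_Ioi]
    simp
  have h2 : gaussianReal 0 v (Set.Iio 0) + gaussianReal 0 v (Set.Ioi 0) = 1 := by
    rw [measure_congr (Ioi_ae_eq_Ici (μ := gaussianReal 0 v) (a := 0)),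
      ← Set.compl_Iio, measure_add_measure_compl measurableSet_Iio, measure_univ]
  rw [h1, ← two_mul] at h2
  rw [ENNReal.eq_div_iff two_ne_zero ENNReal.ofNat_ne_top, h2]

variable {E : Type*} [MeasurableSpace E] (μ : Measure E) [IsProbabilityMeasure μ]

-- Moves the count to the first `m` terms of one infinite i.i.d. sequence, so that a single limit
-- theorem yields a threshold valid for all `n` and `S`.
open Classical in
theorem measure_pi_card_filter_eq {A : Set E} {n m : ℕ} {S : Finset (Fin n)}
    (hS : S.card = m) (hA : MeasurableSet A) (a : ℝ) :
    (Measure.pi fun _ : Fin n => μ) {x | a ≤ (S.filter fun i => x i ∈ A).card} =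
      Measure.infinitePi (fun _ : ℕ => μ)
        {x | a ≤ ∑ k ∈ Finset.range m, A.indicator (fun _ => (1 : ℝ)) (x k)} := by
  have hI : Measurable (A.indicator fun _ => (1 : ℝ)) := measurable_const.indicator hA
  have hB : MeasurableSet {x : Fin m → E | a ≤ ∑ k, A.indicator (fun _ => (1 : ℝ)) (x k)} :=
    measurableSet_le measurable_const
      (Finset.measurable_sum _ fun k _ => hI.comp (measurable_pi_apply k))
  have h1 := Measure.map_infinitePi_infinitePi_of_inj (P := fun _ : Fin n => μ)
    (f := S.orderEmbOfFin hS) (S.orderEmbOfFin hS).injective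
  have h2 := Measure.map_infinitePi_infinitePi_of_inj (P := fun _ : ℕ => μ)
    (f := fun k : Fin m => (k : ℕ)) Fin.val_injective
  rw [Measure.infinitePi_eq_pi] at h1
  have e := h1.trans h2.symm
  have e' := congrArg (fun ν => ν {x : Fin m → E | a ≤ ∑ k, A.indicator (fun _ => (1 : ℝ)) (x k)}) e
  rw [Measure.map_apply (by fun_prop) hB, Measure.map_apply (by fun_prop) hB] at e'
  convert e' using 2
  · ext x
    simp only [Set.mem_ofPred_eq, Set.mem_preimage]
    have : ((S.filter fun i => x i ∈ A).card : ℝ) =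
        ∑ k : Fin m, A.indicator (fun _ => (1 : ℝ)) (x (S.orderEmbOfFin hS k)) := by
      rw [Finset.card_filter]
      push_cast
      rw [← Finset.sum_image (s := Finset.univ) (g := S.orderEmbOfFin hS)
        (f := fun i => A.indicator (fun _ => (1 : ℝ)) (x i))
        (fun _ _ _ _ h => (S.orderEmbOfFin hS).injective h)]
      rw [Finset.image_orderEmbOfFin_univ]
      exact Finset.sum_congr rfl fun i _ => by simp [Set.indicator_apply]
    rw [this]
  · ext x
    simp only [Set.mem_ofPred_eq, Set.mem_preimage]
    rw [Finset.sum_range (fun k => A.indicator (fun _ => (1 : ℝ)) (x k))]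

open Classical in
/-- A binomial variable exceeds its mean with probability asymptotically at least one half. -/
theorem exists_forall_le_measureReal_card_filter {A : Set E} (hA : MeasurableSet A)
    (h0 : μ.real A ≠ 0) (h1 : μ.real A ≠ 1) :
    ∃ N : ℕ, ∀ n m : ℕ, N ≤ m → ∀ S : Finset (Fin n), S.card = m →
      3 / 8 ≤ (Measure.pi fun _ : Fin n => μ).real
        {x | μ.real A * m ≤ (S.filter fun i => x i ∈ A).card} := by
  set I : E → ℝ := A.indicator fun _ => (1 : ℝ) with hIdef
  have hI : Measurable I := measurable_const.indicator hA
  set P := Measure.infinitePi (fun _ : ℕ => μ)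
  set X : ℕ → (ℕ → E) → ℝ := fun i ω => I (ω i) with hX
  have hXm : ∀ i, Measurable (X i) := fun i => hI.comp (measurable_pi_apply i)
  have hI01 : ∀ x, I x = 0 ∨ I x = 1 := fun x => by
    by_cases h : x ∈ A <;> simp [hIdef, h]
  have hindep : iIndepFun X P := iIndepFun_infinitePi fun _ => hI
  have hmap : ∀ i, P.map (X i) = μ.map I := fun i => by
    have : X i = I ∘ fun ω => ω i := rfl
    rw [this, ← Measure.map_map hI (measurable_pi_apply i), Measure.infinitePi_map_eval]
  have hident : ∀ i, IdentDistrib (X i) (X 0) P P := fun i =>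
    ⟨(hXm i).aemeasurable, (hXm 0).aemeasurable, by rw [hmap, hmap]⟩
  have hLp : MemLp (X 0) 2 P := by
    refine MemLp.of_bound (hXm 0).aestronglyMeasurable 1 (Filter.Eventually.of_forall fun ω => ?_)
    rcases hI01 (ω 0) with h | h <;> simp [hX, h]
  have hmean : P[X 0] = μ.real A := by
    have : ∫ ω, X 0 ω ∂P = ∫ x, I x ∂μ := by
      rw [← Measure.infinitePi_map_eval (fun _ : ℕ => μ) 0,
        integral_map (measurable_pi_apply 0).aemeasurable hI.aestronglyMeasurable]
    rw [this, hIdef, integral_indicator hA]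
    simp
  have hvar : Var[X 0; P] = μ.real A - μ.real A ^ 2 := by
    rw [variance_eq_sub hLp, hmean]
    congr 1
    rw [← hmean]
    refine integral_congr_ae (Filter.Eventually.of_forall fun ω => ?_)
    rcases hI01 (ω 0) with h | h <;> simp [hX, h]
  have hq0 : 0 < μ.real A := lt_of_le_of_ne measureReal_nonneg h0.symm
  have hq1 : μ.real A < 1 := lt_of_le_of_ne measureReal_le_one h1
  -- Excluding the masses `0` and `1` keeps the Gaussian limit nondegenerate.
  have hv : 0 < Var[X 0; P] := by rw [hvar]; nlinarith
  have hv' : Var[X 0; P].toNNReal ≠ 0 := by simpa using hv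
  have hclt := tendstoInDistribution_inv_sqrt_mul_sum_sub (P := P)
    (P' := gaussianReal 0 Var[X 0; P].toNNReal) (Y := id) ⟨aemeasurable_id, Measure.map_id⟩ hLp
    hindep hident
  -- Portmanteau on the open half-line: the lower limit is at least `1/2`, hence the probability
  -- eventually exceeds `3/8`.
  have hlim := ProbabilityMeasure.le_liminf_measure_open_of_tendsto hclt.tendsto
    (G := Set.Ioi 0) isOpen_Ioi
  have hgauss : (3 / 8 : ℝ≥0∞) < 1 / 2 := by
    rw [ENNReal.div_lt_iff (by simp) (by simp)]
    rw [ENNReal.div_eq_inv_mul, mul_one]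
    have : (8 : ℝ≥0∞) = 2 * 4 := by norm_num
    rw [this, ← mul_assoc, ENNReal.inv_mul_cancel (by simp) (by simp)]
    norm_num
  have hev := Filter.eventually_lt_of_lt_liminf (lt_of_lt_of_le (b := 1 / 2) hgauss (by
    refine le_trans ?_ hlim
    simp only [ProbabilityMeasure.coe_mk, Measure.map_id]
    rw [gaussianReal_zero_Ioi hv']))
  obtain ⟨N, hN⟩ := Filter.eventually_atTop.1 hev
  refine ⟨N, fun n m hm S hS => ?_⟩
  have h := hN m hm
  simp only [ProbabilityMeasure.coe_mk] at h
  have hZ : Measurable fun ω => (√m)⁻¹ * (∑ k ∈ Finset.range m, X k ω - m * ∫ x, X 0 x ∂P) := by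
    have : Measurable fun ω => ∑ k ∈ Finset.range m, X k ω :=
      Finset.measurable_sum _ fun k _ => hXm k
    fun_prop
  rw [Measure.map_apply hZ measurableSet_Ioi] at h
  rw [measureReal_def, measure_pi_card_filter_eq μ hS hA]
  have h38 : (3 / 8 : ℝ) = (3 / 8 : ℝ≥0∞).toReal := by simp
  rw [h38]
  refine ENNReal.toReal_mono (measure_ne_top _ _) (h.le.trans (measure_mono fun ω hω => ?_))
  simp only [Set.mem_preimage, Set.mem_Ioi, Set.mem_ofPred_eq] at hω ⊢
  rw [hmean] at hω
  have := pos_of_mul_pos_right hω (inv_nonneg.2 (Real.sqrt_nonneg _))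
  simp only [hX] at this
  linarith

end Count

/-! ### The excess cost: measurability, decomposition and expectation -/

section Cost

variable {D n : ℕ}

/-- The infimum over a random set becomes one over all indices, with value `⊤` at those that
contribute no initial positive. -/
theorem measurable_distToPositives (i : Fin n) :
    Measurable fun ω : Outcome D n => distToPositives ω i := by
  classical
  have : ∀ ω : Outcome D n, distToPositives ω i =
      ⨅ j, if j ∈ ω.1 ∧ (ω.2 j).2 = true then edist (ω.2 i).1 (ω.2 j).1 else ⊤ := by
    intro ω
    apply le_antisymm
    · refine le_iInf fun j => ?_
      split_ifs with h
      · exact Metric.infEDist_le_edist_of_mem ⟨j, h.1, h.2, rfl⟩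
      · exact le_top
    · refine Metric.le_infEDist.2 ?_
      rintro _ ⟨j, h1, h2, rfl⟩
      exact (iInf_le _ j).trans (by simp [h1, h2])
  simp_rw [this]
  refine Measurable.iInf fun j => Measurable.ite ?_ ?_ measurable_const
  · refine MeasurableSet.inter (measurable_fst (measurableSet_mem_finset j)) ?_
    have h : Measurable fun ω : Outcome D n => (ω.2 j).2 := by fun_prop
    exact h (measurableSet_singleton true)
  · have h1 : Measurable fun ω : Outcome D n => (ω.2 i).1 := by fun_prop
    have h2 : Measurable fun ω : Outcome D n => (ω.2 j).1 := by fun_prop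
    exact h1.edist h2

theorem measurableSet_queriedUpTo (j i : Fin n) :
    MeasurableSet {ω : Outcome D n | QueriedUpTo ω j i} := by
  have hj := measurable_distToPositives (D := D) j
  have hi := measurable_distToPositives (D := D) i
  refine (measurableSet_lt hj hi).union ((measurableSet_eq_fun hj hi).inter ?_)
  exact MeasurableSet.const _

theorem measurableSet_label (i : Fin n) :
    MeasurableSet {ω : Outcome D n | (ω.2 i).2 = true} := by
  have h : Measurable fun ω : Outcome D n => (ω.2 i).2 := by fun_prop
  exact h (measurableSet_singleton true)

theorem mem_queried {ω : Outcome D n} {j : Fin n} :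
    j ∈ queried ω ↔ j ∈ ω.1 ∨ ∃ i, i ∉ ω.1 ∧ (ω.2 i).2 = true ∧ QueriedUpTo ω j i := by
  simp [queried]

theorem measurableSet_mem_queried (j : Fin n) :
    MeasurableSet {ω : Outcome D n | j ∈ queried ω} := by
  simp only [mem_queried]
  refine MeasurableSet.union (measurable_fst (measurableSet_mem_finset j)) ?_
  have : {ω : Outcome D n | ∃ i, i ∉ ω.1 ∧ (ω.2 i).2 = true ∧ QueriedUpTo ω j i} =
      ⋃ i, {ω | i ∉ ω.1 ∧ (ω.2 i).2 = true ∧ QueriedUpTo ω j i} := by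
    ext; simp
  change MeasurableSet {ω : Outcome D n | ∃ i, i ∉ ω.1 ∧ (ω.2 i).2 = true ∧ QueriedUpTo ω j i}
  rw [this]
  refine MeasurableSet.iUnion fun i => ?_
  exact (measurable_fst (measurableSet_notMem_finset i)).inter
    ((measurableSet_label i).inter (measurableSet_queriedUpTo j i))

variable (Pp : Measure (Pt D))

theorem mem_optimalQueried {ω : Outcome D n} {j : Fin n} :
    j ∈ optimalQueried Pp ω ↔ (ω.2 j).1 ∈ Pp.support := by
  simp [optimalQueried]

theorem measurableSet_mem_optimalQueried (j : Fin n) :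
    MeasurableSet {ω : Outcome D n | j ∈ optimalQueried Pp ω} := by
  simp only [mem_optimalQueried]
  have h : Measurable fun ω : Outcome D n => (ω.2 j).1 := by fun_prop
  exact h Measure.isClosed_support.measurableSet

theorem measurable_card_of_measurableSet_mem {Ω ι : Type*} [MeasurableSpace Ω] [Fintype ι]
    {Q : Ω → Finset ι} (h : ∀ j, MeasurableSet {ω | j ∈ Q ω}) :
    Measurable fun ω => ((Q ω).card : ℝ) := by
  classical
  have : ∀ ω, ((Q ω).card : ℝ) = ∑ j, if j ∈ Q ω then (1 : ℝ) else 0 := by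
    intro ω; simp
  simp_rw [this]
  exact Finset.measurable_sum _ fun j _ => Measurable.ite (h j) measurable_const measurable_const

theorem measurable_excessCost : Measurable (excessCost (n := n) Pp) :=
  (measurable_card_of_measurableSet_mem measurableSet_mem_queried).sub
    (measurable_card_of_measurableSet_mem (measurableSet_mem_optimalQueried Pp))

theorem abs_excessCost_le (ω : Outcome D n) : |excessCost Pp ω| ≤ n := by
  have h1 : ((queried ω).card : ℝ) ≤ n := by exact_mod_cast card_finset_fin_le _
  have h2 : ((optimalQueried Pp ω).card : ℝ) ≤ n := by exact_mod_cast card_finset_fin_le _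
  rw [excessCost, abs_le]
  constructor <;> linarith [Nat.cast_nonneg (α := ℝ) (queried ω).card,
    Nat.cast_nonneg (α := ℝ) (optimalQueried Pp ω).card]

open Classical in
/-- The excess cost as a sum of three parts: the initial examples outside the support, the further
queries outside the support, and the examples in the support which are never queried. -/
theorem excessCost_eq (ω : Outcome D n) :
    excessCost Pp ω = (ω.1.filter fun i => (ω.2 i).1 ∉ Pp.support).card
      + ∑ j ∈ ω.1ᶜ, (if (ω.2 j).1 ∉ Pp.support ∧ j ∈ queried ω then (1 : ℝ) else 0)
      - ∑ j ∈ ω.1ᶜ, (if (ω.2 j).1 ∈ Pp.support ∧ j ∉ queried ω then (1 : ℝ) else 0) := by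
  have h1 : ((queried ω).card : ℝ) = ∑ j, if j ∈ queried ω then (1 : ℝ) else 0 := by simp
  have h2 : ((optimalQueried Pp ω).card : ℝ) =
      ∑ j, if j ∈ optimalQueried Pp ω then (1 : ℝ) else 0 := by simp
  rw [excessCost, h1, h2, ← Finset.sum_sub_distrib, ← Finset.sum_add_sum_compl ω.1,
    add_sub_assoc, ← Finset.sum_sub_distrib, Finset.card_filter]
  push_cast
  congr 1
  · refine Finset.sum_congr rfl fun i hi => ?_
    have : i ∈ queried ω := mem_queried.2 (Or.inl hi)
    by_cases h : (ω.2 i).1 ∈ Pp.support <;> simp [this, mem_optimalQueried, h]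
  · refine Finset.sum_congr rfl fun i _ => ?_
    by_cases h : (ω.2 i).1 ∈ Pp.support <;> by_cases h' : i ∈ queried ω <;>
      simp [mem_optimalQueried, h, h']

theorem initialPositives_merge (S : Finset (Fin n)) (x y : Fin n → Pt D × Bool) :
    initialPositives (S, merge S x y) = initialPositives (S, x) := by
  ext t
  simp only [initialPositives, Set.mem_ofPred_eq]
  refine exists_congr fun i => and_congr_right fun hi => ?_
  rw [merge_of_mem hi]

/-- Breaking ties by index makes the order total; this is what rules out two last positives. -/
theorem queriedUpTo_total {ω : Outcome D n} (i j : Fin n) :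
    QueriedUpTo ω i j ∨ QueriedUpTo ω j i := by
  unfold QueriedUpTo
  rcases lt_trichotomy (distToPositives ω i) (distToPositives ω j) with h | h | h
  · exact Or.inl (Or.inl h)
  · rcases le_total i j with h' | h'
    · exact Or.inl (Or.inr ⟨h, h'⟩)
    · exact Or.inr (Or.inr ⟨h.symm, h'⟩)
  · exact Or.inr (Or.inl h)

/-- Labels off the initial sample do not enter the distances, so changing one leaves the order
intact. -/
theorem queriedUpTo_merge_congr {S : Finset (Fin n)} {x y y' : Fin n → Pt D × Bool} {i j : Fin n}
    (h : ∀ k, (y k).1 = (y' k).1) :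
    QueriedUpTo (S, merge S x y) j i ↔ QueriedUpTo (S, merge S x y') j i := by
  have key : ∀ k, distToPositives (S, merge S x y) k = distToPositives (S, merge S x y') k := by
    intro k
    simp only [distToPositives, initialPositives_merge]
    by_cases hk : k ∈ S
    · simp only [merge_of_mem hk]
    · simp only [merge_of_notMem hk, h k]
  simp only [QueriedUpTo, key]

variable (μ : Measure (Pt D × Bool)) [IsProbabilityMeasure μ]

theorem measurable_prodMk_merge (S : Finset (Fin n)) (x : Fin n → Pt D × Bool) :
    Measurable fun y : Fin n → Pt D × Bool => ((S, merge S x y) : Outcome D n) :=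
  measurable_const.prodMk ((measurable_merge S).comp (measurable_const.prodMk measurable_id))

/-- The expected number of the examples in the support which are never queried is bounded. -/
theorem sum_measure_notMem_queried_le (S : Finset (Fin n)) (x : Fin n → Pt D × Bool) {κ : ℝ≥0∞}
    (hκ : ∀ F : Set (Pt D), MeasurableSet F →
      μ ((F ∩ Pp.support) ×ˢ {false}) ≤ κ * μ (F ×ˢ {true})) :
    ∑ j ∈ Sᶜ, Measure.pi (fun _ => μ) {y : Fin n → Pt D × Bool |
      (merge S x y j).1 ∈ Pp.support ∧ j ∉ queried (S, merge S x y)} ≤ κ := by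
  set A : Fin n → Set (Fin n → Pt D × Bool) := fun j => {y |
      (merge S x y j).1 ∈ Pp.support ∧ j ∉ queried (S, merge S x y)} with hA
  -- `B j` says that `j` is the last remaining positive. Relabelling `j` as positive leads from `A
  -- j` to `B j`.
  set B : Fin n → Set (Fin n → Pt D × Bool) := fun j => {y | (y j).2 = true ∧
      ∀ i ∉ S, i ≠ j → (y i).2 = true → ¬ QueriedUpTo (S, merge S x y) j i} with hB
  have hAm : ∀ j, MeasurableSet (A j) := fun j => by
    have h := (measurableSet_mem_optimalQueried Pp j).inter (measurableSet_mem_queried j).compl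
    simp only [mem_optimalQueried] at h
    exact measurable_prodMk_merge S x h
  have hlab : ∀ i : Fin n, MeasurableSet {y : Fin n → Pt D × Bool | (y i).2 = true} := fun i => by
    have h : Measurable fun y : Fin n → Pt D × Bool => (y i).2 := by fun_prop
    exact h (measurableSet_singleton true)
  have hBm : ∀ j, MeasurableSet (B j) := by
    intro j
    refine (hlab j).inter ?_
    change MeasurableSet {y : Fin n → Pt D × Bool |
      ∀ i ∉ S, i ≠ j → (y i).2 = true → ¬ QueriedUpTo (S, merge S x y) j i}
    simp only [Set.ofPred_forall]
    refine MeasurableSet.iInter fun i => MeasurableSet.iInter fun _ =>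
      MeasurableSet.iInter fun _ => ?_
    refine (hlab i).imp ?_
    exact (measurable_prodMk_merge S x (measurableSet_queriedUpTo j i)).compl
  have hAB : ∀ j ∈ Sᶜ, Measure.pi (fun _ => μ) (A j) ≤ κ * Measure.pi (fun _ => μ) (B j) := by
    intro j hj
    rw [Finset.mem_compl] at hj
    refine measure_pi_le_mul_of_update μ j (hAm j) (hBm j) κ fun y => ?_
    -- With the other examples fixed, `F` collects the positions at which a positive `j` would be
    -- last. The section of `A j` lies over `F` and the support with label `false`.
    set F : Set (Pt D) := {t | Function.update y j (t, true) ∈ B j} with hF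
    have hFm : MeasurableSet F := by
      have : Measurable fun t : Pt D => Function.update y j (t, true) :=
        (measurable_update y).comp measurable_prodMk_right
      exact this (hBm j)
    refine (measure_mono ?_).trans ((hκ F hFm).trans (mul_le_mul_right (measure_mono ?_) κ))
    · rintro ⟨t, b⟩ ⟨h1, h2⟩
      rw [merge_of_notMem hj] at h1
      simp only [Function.update_self] at h1
      rw [mem_queried] at h2
      push Not at h2
      -- A remaining positive example is always queried, on its own account.
      have hb : b = false := by
        by_contra hb
        refine h2.2 j hj ?_ ((queriedUpTo_total j j).elim id id)
        simpa [merge_of_notMem hj] using hb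
      subst hb
      refine ⟨⟨⟨by simp, fun i hi hij hyi hq => ?_⟩, h1⟩, rfl⟩
      refine h2.2 i hi ?_ ?_
      · simpa [merge_of_notMem hi, hij] using hyi
      · refine (queriedUpTo_merge_congr fun k => ?_).1 hq
        by_cases hk : k = j
        · subst hk; simp
        · simp [hk]
    · rintro ⟨t, b⟩ ⟨h1, h2⟩
      obtain rfl : b = true := h2
      exact h1
  calc ∑ j ∈ Sᶜ, Measure.pi (fun _ => μ) (A j)
      ≤ ∑ j ∈ Sᶜ, κ * Measure.pi (fun _ => μ) (B j) := Finset.sum_le_sum hAB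
    _ = κ * Measure.pi (fun _ => μ) (⋃ j ∈ Sᶜ, B j) := by
      rw [← Finset.mul_sum, measure_biUnion_finset _ fun j _ => hBm j]
      -- Two distinct last positives would each have to come strictly after the other.
      intro i hi j hj hij
      simp only [Finset.coe_compl, Set.mem_compl_iff, Finset.mem_coe] at hi hj
      refine Set.disjoint_left.2 fun y hyi hyj => ?_
      rcases queriedUpTo_total (ω := (S, merge S x y)) i j with h | h
      · exact hyi.2 j hj hij.symm hyj.1 h
      · exact hyj.2 i hi hij hyi.1 h
    _ ≤ κ := by
      calc _ ≤ κ * 1 := by gcongr; exact prob_le_one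
        _ = κ := mul_one κ

/-- A negative example in `W` is queried if some remaining positive example is in `H`. -/
theorem le_measureReal_mem_queried (S : Finset (Fin n)) (x : Fin n → Pt D × Bool)
    {W H : Set (Pt D)} (hW : MeasurableSet W) (hH : MeasurableSet H)
    (hWK : Disjoint W Pp.support)
    (hWH : ∀ w ∈ W, ∀ h ∈ H, Metric.infEDist w (initialPositives (S, x)) <
      Metric.infEDist h (initialPositives (S, x))) {j : Fin n} (hj : j ∉ S) :
    μ.real (W ×ˢ Set.univ) * (1 - (1 - μ.real (H ×ˢ {true})) ^ (Sᶜ.card - 1)) ≤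
    (Measure.pi (fun _ => μ)).real {y : Fin n → Pt D × Bool |
      (merge S x y j).1 ∉ Pp.support ∧ j ∈ queried (S, merge S x y)} := by
  classical
  have hHm : MeasurableSet (H ×ˢ ({true} : Set Bool)) := hH.prod (measurableSet_singleton _)
  have hWm : MeasurableSet (W ×ˢ (Set.univ : Set Bool)) := hW.prod MeasurableSet.univ
  -- `R` only puts example `j` in `W`; `T` also forbids a positive in `H` among the other `Sᶜ.card -
  -- 1` remaining examples. On `R \ T` some positive in `H` is farther away than `j`, which forces
  -- the query.
  set s : Fin n → Set (Pt D × Bool) := fun i =>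
    if i = j then W ×ˢ Set.univ else (H ×ˢ {true})ᶜ with hs
  set R : Set (Fin n → Pt D × Bool) := {y | ∀ i ∈ ({j} : Finset (Fin n)), y i ∈ s i} with hR
  set T : Set (Fin n → Pt D × Bool) := {y | ∀ i ∈ Sᶜ, y i ∈ s i} with hT
  have hjc : j ∈ Sᶜ := Finset.mem_compl.2 hj
  have hsm : ∀ i, MeasurableSet (s i) := fun i => by
    simp only [hs]; split_ifs
    · exact hWm
    · exact hHm.compl
  have hTm : MeasurableSet T := by
    simp only [hT, Set.ofPred_forall]
    exact MeasurableSet.iInter fun i => MeasurableSet.iInter fun _ =>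
      measurable_pi_apply i (hsm i)
  have hTR : T ⊆ R := fun y hy i hi => hy i (by rw [Finset.mem_singleton.1 hi]; exact hjc)
  have hRv : (Measure.pi (fun _ => μ)).real R = μ.real (W ×ˢ Set.univ) := by
    rw [measureReal_def, hR, measure_pi_finset_pi]
    simp [hs, measureReal_def]
  have hTv : (Measure.pi (fun _ => μ)).real T =
      μ.real (W ×ˢ Set.univ) * (1 - μ.real (H ×ˢ {true})) ^ (Sᶜ.card - 1) := by
    rw [measureReal_def, hT, measure_pi_finset_pi, ENNReal.toReal_prod,
      ← Finset.mul_prod_erase _ _ hjc]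
    congr 1
    · simp [hs, measureReal_def]
    · rw [← Finset.card_erase_of_mem hjc, ← Finset.prod_const]
      refine Finset.prod_congr rfl fun i hi => ?_
      rw [← probReal_compl_eq_one_sub hHm]
      simp [hs, Finset.ne_of_mem_erase hi, measureReal_def]
  have hdiff : (Measure.pi (fun _ => μ)).real (R \ T) =
      μ.real (W ×ˢ Set.univ) * (1 - (1 - μ.real (H ×ˢ {true})) ^ (Sᶜ.card - 1)) := by
    rw [measureReal_sdiff hTR hTm, hRv, hTv]; ring
  rw [← hdiff]
  refine measureReal_mono ?_
  rintro y ⟨hyR, hyT⟩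
  have hyj : (y j).1 ∈ W := by
    have := hyR j (Finset.mem_singleton_self j)
    simpa [hs] using this
  simp only [hT, Set.mem_ofPred_eq] at hyT
  push Not at hyT
  obtain ⟨i, hi, hyi⟩ := hyT
  have hij : i ≠ j := by
    rintro rfl
    exact hyi (hyR i (Finset.mem_singleton_self i))
  simp only [hs, if_neg hij, Set.mem_compl_iff, not_not] at hyi
  rw [Finset.mem_compl] at hi
  simp only [Set.mem_ofPred_eq]
  refine ⟨?_, mem_queried.2 (Or.inr ⟨i, hi, ?_, Or.inl ?_⟩)⟩
  · rw [merge_of_notMem hj]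
    exact Set.disjoint_left.1 hWK hyj
  · simpa [merge_of_notMem hi] using hyi.2
  · simp only [distToPositives, initialPositives_merge, merge_of_notMem hi, merge_of_notMem hj]
    exact hWH _ hyj _ hyi.1

-- Takes expectations in `excessCost_eq`: the initial term is constant in `y`, each further query
-- outside the support is bounded below through a near set `W` and a far set `H`, and the unqueried
-- examples of the support cost at most `κ`.
open Classical in
theorem le_integral_excessCost (S : Finset (Fin n)) (x : Fin n → Pt D × Bool) {κ : NNReal}
    (hκ : ∀ F : Set (Pt D), MeasurableSet F →
      μ ((F ∩ Pp.support) ×ˢ {false}) ≤ κ * μ (F ×ˢ {true}))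
    {W H : Set (Pt D)} (hW : MeasurableSet W) (hH : MeasurableSet H)
    (hWK : Disjoint W Pp.support)
    (hWH : ∀ w ∈ W, ∀ h ∈ H, Metric.infEDist w (initialPositives (S, x)) <
      Metric.infEDist h (initialPositives (S, x))) :
    ((S.filter fun i => (x i).1 ∉ Pp.support).card : ℝ) +
      Sᶜ.card * (μ.real (W ×ˢ Set.univ) *
        (1 - (1 - μ.real (H ×ˢ {true})) ^ (Sᶜ.card - 1))) - κ ≤
    ∫ y, excessCost Pp (S, merge S x y) ∂Measure.pi fun _ => μ := by
  set A : Fin n → Set (Fin n → Pt D × Bool) := fun j => {y |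
      (merge S x y j).1 ∈ Pp.support ∧ j ∉ queried (S, merge S x y)} with hA
  set G : Fin n → Set (Fin n → Pt D × Bool) := fun j => {y |
      (merge S x y j).1 ∉ Pp.support ∧ j ∈ queried (S, merge S x y)} with hG
  have hopt : ∀ j, MeasurableSet {y : Fin n → Pt D × Bool | (merge S x y j).1 ∈ Pp.support} :=
    fun j => by
      have h := measurableSet_mem_optimalQueried (n := n) Pp j
      simp only [mem_optimalQueried] at h
      exact measurable_prodMk_merge S x h
  have hq : ∀ j, MeasurableSet {y : Fin n → Pt D × Bool | j ∈ queried (S, merge S x y)} :=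
    fun j => measurable_prodMk_merge S x (measurableSet_mem_queried j)
  have hAm : ∀ j, MeasurableSet (A j) := fun j => (hopt j).inter (hq j).compl
  have hGm : ∀ j, MeasurableSet (G j) := fun j => (hopt j).compl.inter (hq j)
  have heq : ∀ y, excessCost Pp (S, merge S x y) =
      ((S.filter fun i => (x i).1 ∉ Pp.support).card : ℝ) +
        ∑ j ∈ Sᶜ, (G j).indicator (fun _ => (1 : ℝ)) y -
        ∑ j ∈ Sᶜ, (A j).indicator (fun _ => (1 : ℝ)) y := by
    intro y
    rw [excessCost_eq]
    have hcard : (S.filter fun i => (merge S x y i).1 ∉ Pp.support) =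
        S.filter fun i => (x i).1 ∉ Pp.support :=
      Finset.filter_congr fun i hi => by rw [merge_of_mem hi]
    simp only [hcard, hA, hG, Set.indicator_apply, Set.mem_ofPred_eq]
  have hint : ∀ s : Set (Fin n → Pt D × Bool), MeasurableSet s →
      Integrable (s.indicator fun _ => (1 : ℝ)) (Measure.pi fun _ => μ) :=
    fun s hs => (integrable_const _).indicator hs
  have hsum : ∀ T : Fin n → Set (Fin n → Pt D × Bool), (∀ j, MeasurableSet (T j)) →
      ∫ y, ∑ j ∈ Sᶜ, (T j).indicator (fun _ => (1 : ℝ)) y ∂(Measure.pi fun _ => μ) =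
        ∑ j ∈ Sᶜ, (Measure.pi fun _ => μ).real (T j) := by
    intro T hT
    rw [integral_finsetSum _ fun j _ => hint _ (hT j)]
    refine Finset.sum_congr rfl fun j _ => ?_
    rw [integral_indicator (hT j)]
    simp
  simp_rw [heq]
  rw [integral_sub, integral_add, hsum G hGm, hsum A hAm, integral_const]
  · have hA' : ∑ j ∈ Sᶜ, (Measure.pi fun _ => μ).real (A j) ≤ κ := by
      have := sum_measure_notMem_queried_le Pp μ S x hκ
      have h2 := ENNReal.toReal_mono ENNReal.coe_ne_top this
      rw [ENNReal.toReal_sum fun _ _ => measure_ne_top _ _] at h2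
      exact h2
    have hG' : ∑ _j ∈ Sᶜ, (μ.real (W ×ˢ Set.univ) *
        (1 - (1 - μ.real (H ×ˢ {true})) ^ (Sᶜ.card - 1))) ≤
        ∑ j ∈ Sᶜ, (Measure.pi fun _ => μ).real (G j) :=
      Finset.sum_le_sum fun j hj => le_measureReal_mem_queried Pp μ S x hW hH hWK hWH
        (Finset.mem_compl.1 hj)
    rw [Finset.sum_const, nsmul_eq_mul] at hG'
    simp only [probReal_univ, one_smul]
    linarith
  · exact integrable_const _
  · exact integrable_finsetSum _ fun j _ => hint _ (hGm j)
  · exact (integrable_const _).add (integrable_finsetSum _ fun j _ => hint _ (hGm j))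
  · exact integrable_finsetSum _ fun j _ => hint _ (hAm j)

end Cost

/-! ### Cubes, uniform distributions and grid cells -/

section Geometry

variable {D : ℕ}

theorem volume_forall_mem (s : Fin D → Set ℝ) :
    volume {x : Pt D | ∀ i, x i ∈ s i} = ∏ i, volume (s i) := by
  rw [← volume_pi_pi,
    ← (PiLp.volume_preserving_ofLp (Fin D)).measure_preimage_equiv
      (f := (MeasurableEquiv.toLp 2 (Fin D → ℝ)).symm) (Set.univ.pi s)]
  congr 1
  ext x
  simp

theorem measurableSet_forall_mem {s : Fin D → Set ℝ} (hs : ∀ i, MeasurableSet (s i)) :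
    MeasurableSet {x : Pt D | ∀ i, x i ∈ s i} := by
  rw [Set.ofPred_forall]
  refine MeasurableSet.iInter fun i => ?_
  have h : Measurable fun x : Pt D => x i := by fun_prop
  exact h (hs i)

/-- The factor `D` in place of `√D` is crude, but only affects constants. -/
theorem dist_le_of_forall_abs_sub_le {x y : Pt D} {r : ℝ} (hr : 0 ≤ r)
    (h : ∀ i, |x i - y i| ≤ r) : dist x y ≤ D * r := by
  rw [EuclideanSpace.dist_eq]
  refine Real.sqrt_le_iff.2 ⟨by positivity, ?_⟩
  calc ∑ i, dist (x i) (y i) ^ 2 ≤ ∑ _i : Fin D, r ^ 2 :=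
        Finset.sum_le_sum fun i _ => by
          rw [Real.dist_eq]
          exact pow_le_pow_left₀ (abs_nonneg _) (h i) 2
    _ = D * r ^ 2 := by simp
    _ ≤ (D * r) ^ 2 := by
      rw [mul_pow]
      refine mul_le_mul_of_nonneg_right ?_ (by positivity)
      exact_mod_cast Nat.le_self_pow two_ne_zero D

theorem abs_sub_le_dist (x y : Pt D) (i : Fin D) : |x i - y i| ≤ dist x y := by
  rw [EuclideanSpace.dist_eq]
  refine Real.le_sqrt_of_sq_le ?_
  have := Finset.single_le_sum (f := fun i => dist (x i) (y i) ^ 2)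
    (fun i _ => sq_nonneg _) (Finset.mem_univ i)
  simpa [Real.dist_eq] using this

theorem cube_eq (a b : ℝ) : cube D a b = {x | ∀ i, x i ∈ Set.Icc a b} := rfl

theorem volume_cube (a b : ℝ) : volume (cube D a b) = ENNReal.ofReal (b - a) ^ D := by
  simp only [cube_eq, volume_forall_mem, Real.volume_Icc]
  simp

theorem measurableSet_cube (a b : ℝ) : MeasurableSet (cube D a b) :=
  measurableSet_forall_mem fun _ => measurableSet_Icc

theorem isClosed_cube (a b : ℝ) : IsClosed (cube D a b) := by
  rw [cube_eq, Set.ofPred_forall]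
  refine isClosed_iInter fun i => ?_
  have h : Continuous fun x : Pt D => x i := by fun_prop
  exact isClosed_Icc.preimage h

theorem isCompact_cube (a b : ℝ) : IsCompact (cube D a b) := by
  refine Metric.isCompact_of_isClosed_isBounded (isClosed_cube a b) ?_
  refine (Metric.isBounded_closedBall (x := (0 : Pt D)) (r := D * (|a| + |b|))).subset fun x hx => ?_
  refine dist_le_of_forall_abs_sub_le (by positivity) fun i => ?_
  have := hx i
  rw [abs_le]
  simp only [PiLp.zero_apply, sub_zero]
  constructor
  · linarith [neg_abs_le a, abs_nonneg b]
  · linarith [le_abs_self b, abs_nonneg a]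

theorem isPreconnected_cube (a b : ℝ) : IsPreconnected (cube D a b) := by
  have : Convex ℝ (cube D a b) := by
    intro x hx y hy s t hs ht hst i
    exact (convex_Icc a b) (hx i) (hy i) hs ht hst
  exact this.isPreconnected

/-- From `x` a box of side `r / D` is drawn with every edge pointing towards the farther face; it
stays in the cube because `r ≤ 1 / 2`, and in the ball by the coordinatewise bound. -/
theorem le_volume_closedBall_inter_cube {x : Pt D} (hx : x ∈ cube D 0 1) {r : ℝ} (hr0 : 0 < r)
    (hr : r ≤ 1 / 2) :
    ENNReal.ofReal (r / D) ^ D ≤ volume (Metric.closedBall x r ∩ cube D 0 1) := by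
  rcases Nat.eq_zero_or_pos D with rfl | hD
  · have : Metric.closedBall x r ∩ cube 0 0 1 = {x : Pt 0 | ∀ i, x i ∈ Set.Icc (0 : ℝ) 1} := by
      ext y
      simp [cube, Subsingleton.elim y x, hr0.le]
    rw [this, volume_forall_mem]
    simp
  have hD1 : (1 : ℝ) ≤ D := by exact_mod_cast hD
  have hrD : r / D ≤ r := div_le_self hr0.le hD1
  have hrD0 : 0 < r / D := by positivity
  set a : Fin D → ℝ := fun i => if x i ≤ 1 / 2 then x i else x i - r / D with ha
  have hsub : {y : Pt D | ∀ i, y i ∈ Set.Icc (a i) (a i + r / D)} ⊆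
      Metric.closedBall x r ∩ cube D 0 1 := by
    intro y hy
    have key : ∀ i, |y i - x i| ≤ r / D ∧ 0 ≤ y i ∧ y i ≤ 1 := by
      intro i
      have h := hy i
      have hxi := hx i
      simp only [ha, Set.mem_Icc] at h
      rw [abs_le]
      split_ifs at h with hc
      · refine ⟨⟨?_, ?_⟩, ?_, ?_⟩ <;> linarith
      · refine ⟨⟨?_, ?_⟩, ?_, ?_⟩ <;> linarith
    refine ⟨?_, fun i => (key i).2⟩
    have := dist_le_of_forall_abs_sub_le hrD0.le fun i => (key i).1
    rwa [mul_div_cancel₀ _ (by positivity)] at this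
  refine le_trans ?_ (measure_mono hsub)
  rw [volume_forall_mem]
  simp

theorem volume_closedBall_le (x : Pt D) (r : ℝ) :
    volume (Metric.closedBall x r) ≤ ENNReal.ofReal (2 * r) ^ D := by
  have hsub : Metric.closedBall x r ⊆ {y : Pt D | ∀ i, y i ∈ Set.Icc (x i - r) (x i + r)} := by
    intro y hy i
    have := (abs_sub_le_dist y x i).trans hy
    rw [abs_le] at this
    constructor <;> linarith
  refine (measure_mono hsub).trans ?_
  rw [volume_forall_mem]
  have : ∀ i, x i + r - (x i - r) = 2 * r := fun i => by ring
  simp [this]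

theorem uniformDist_apply {s : Set (Pt D)} (hs : MeasurableSet s) (A : Set (Pt D)) :
    uniformDist s A = (volume s)⁻¹ * volume (s ∩ A) :=
  cond_apply hs _ _

theorem uniformDist_unitCube_apply (A : Set (Pt D)) :
    uniformDist (cube D 0 1) A = volume (cube D 0 1 ∩ A) := by
  rw [uniformDist_apply (measurableSet_cube 0 1), volume_cube]
  simp

theorem isDensity_uniformDist {s : Set (Pt D)} (hs : MeasurableSet s) (h0 : volume s ≠ 0)
    (htop : volume s ≠ ∞) :
    IsDensity (s.indicator fun _ => (volume.real s)⁻¹) (uniformDist s) := by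
  refine ⟨measurable_const.indicator hs, fun x => Set.indicator_nonneg (fun _ _ => by positivity) x,
    ?_⟩
  have : (fun x => ENNReal.ofReal (s.indicator (fun _ => (volume.real s)⁻¹) x)) =
      s.indicator fun _ => (volume s)⁻¹ := by
    ext x
    by_cases hx : x ∈ s
    · simp only [Set.indicator_of_mem hx]
      rw [measureReal_def, ENNReal.ofReal_inv_of_pos (ENNReal.toReal_pos h0 htop),
        ENNReal.ofReal_toReal htop]
    · simp [hx]
  rw [this, withDensity_indicator hs, withDensity_const]
  rfl

theorem isProbabilityMeasure_uniformDist {s : Set (Pt D)} (h0 : volume s ≠ 0)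
    (htop : volume s ≠ ∞) : IsProbabilityMeasure (uniformDist s) :=
  cond_isProbabilityMeasure_of_finite h0 htop

theorem negativeAssumption_uniformDist {s : Set (Pt D)} (hs : MeasurableSet s)
    (h0 : volume s ≠ 0) (htop : volume s ≠ ∞) : NegativeAssumption (uniformDist s) := by
  have hpos : 0 < volume.real s := ENNReal.toReal_pos h0 htop
  refine ⟨_, isDensity_uniformDist hs h0 htop, (volume.real s)⁻¹, by positivity, fun x => ?_⟩
  exact Set.indicator_le_self' (fun _ _ => by positivity) x

theorem support_uniformDist_unitCube : (uniformDist (cube D 0 1)).support = cube D 0 1 := by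
  apply Set.Subset.antisymm
  · refine Measure.support_subset_of_isClosed (isClosed_cube 0 1) ?_
    exact ae_cond_mem (measurableSet_cube 0 1)
  · intro x hx
    rw [Measure.mem_support_iff_forall]
    intro U hU
    obtain ⟨r, hr, hrU⟩ := Metric.nhds_basis_closedBall.mem_iff.1 hU
    rw [uniformDist_unitCube_apply]
    refine lt_of_lt_of_le ?_ ((le_volume_closedBall_inter_cube hx (r := min r (1 / 2))
      (by positivity) (min_le_right _ _)).trans (measure_mono ?_))
    · rcases Nat.eq_zero_or_pos D with rfl | hD
      · simp
      · exact ENNReal.pow_pos (by simp; positivity) D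
    · rw [Set.inter_comm]
      exact Set.inter_subset_inter_right _
        ((Metric.closedBall_subset_closedBall (min_le_left _ _)).trans hrU)

theorem positiveAssumption_uniformDist_unitCube (hD : 1 ≤ D) :
    PositiveAssumption (uniformDist (cube D 0 1)) := by
  have hvol : volume (cube D 0 1) = 1 := by simp [volume_cube]
  have hreal : (volume.real (cube D 0 1))⁻¹ = 1 := by simp [measureReal_def, hvol]
  have hD0 : (0 : ℝ) < D := by exact_mod_cast hD
  refine ⟨_, isDensity_uniformDist (measurableSet_cube 0 1) (by simp [hvol]) (by simp [hvol]),
    ?_, ?_, ?_, ?_⟩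
  · rw [support_uniformDist_unitCube, tsupport, Set.support_indicator, hreal]
    have : Function.support (fun _ : Pt D => (1 : ℝ)) = Set.univ := by ext; simp
    rw [this, Set.inter_univ, (isClosed_cube 0 1).closure_eq]
  · rw [support_uniformDist_unitCube]; exact isCompact_cube 0 1
  · rw [support_uniformDist_unitCube]
    have : PreconnectedSpace (cube D 0 1) :=
      isPreconnected_iff_preconnectedSpace.1 (isPreconnected_cube 0 1)
    infer_instance
  -- The thickness constant compares the box of side `r / D` inside the intersection with the box of
  -- side `2 r` around the ball.
  · refine ⟨1, 1 / 2, (1 / (2 * D)) ^ D, one_pos, by norm_num, by positivity, ?_, ?_⟩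
    · intro x hx
      rw [support_uniformDist_unitCube] at hx
      rw [Set.indicator_of_mem hx, hreal]
    · intro r hr0 hr x hx
      rw [support_uniformDist_unitCube] at hx ⊢
      refine le_trans ?_ (le_volume_closedBall_inter_cube hx hr0 hr.le)
      refine (mul_le_mul_right (volume_closedBall_le x r) _).trans ?_
      rw [ENNReal.ofReal_pow (by positivity), ← mul_pow, ← ENNReal.ofReal_mul (by positivity)]
      refine le_of_eq ?_
      congr 2
      field_simp

/-- The cell with index `v` of the grid of width `1 / k`. -/
def cell (k : ℕ) (v : Fin D → ℤ) : Set (Pt D) :=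
  {x | ∀ i, x i ∈ Set.Ico ((v i : ℝ) / k) ((v i + 1 : ℝ) / k)}

/-- The middle third of a grid cell. -/
def cellCore (k : ℕ) (v : Fin D → ℤ) : Set (Pt D) :=
  {x | ∀ i, x i ∈ Set.Ico ((v i + 1 / 3 : ℝ) / k) ((v i + 2 / 3 : ℝ) / k)}

theorem measurableSet_cell (k : ℕ) (v : Fin D → ℤ) : MeasurableSet (cell k v) :=
  measurableSet_forall_mem fun _ => measurableSet_Ico

theorem measurableSet_cellCore (k : ℕ) (v : Fin D → ℤ) : MeasurableSet (cellCore k v) :=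
  measurableSet_forall_mem fun _ => measurableSet_Ico

theorem volume_cell (k : ℕ) (v : Fin D → ℤ) :
    volume (cell k v) = ENNReal.ofReal ((1 / k : ℝ) ^ D) := by
  have : ∀ i, ((v i : ℝ) + 1) / k - v i / k = 1 / k := fun i => by ring
  rw [ENNReal.ofReal_pow (by positivity)]
  simp only [cell, volume_forall_mem, Real.volume_Ico, this]
  simp

theorem volume_cellCore (k : ℕ) (v : Fin D → ℤ) :
    volume (cellCore k v) = ENNReal.ofReal ((1 / (3 * k) : ℝ) ^ D) := by
  have : ∀ i, ((v i : ℝ) + 2 / 3) / k - (v i + 1 / 3) / k = 1 / (3 * k) := fun i => by ring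
  rw [ENNReal.ofReal_pow (by positivity)]
  simp only [cellCore, volume_forall_mem, Real.volume_Ico, this]
  simp

theorem disjoint_cell {k : ℕ} (hk : 0 < k) {v w : Fin D → ℤ} (h : v ≠ w) :
    Disjoint (cell k v) (cell k w) := by
  refine Set.disjoint_left.2 fun x hv hw => h (funext fun i => ?_)
  have hk' : (0 : ℝ) < k := by exact_mod_cast hk
  have h1 := hv i
  have h2 := hw i
  simp only [Set.mem_Ico, div_le_iff₀ hk', lt_div_iff₀ hk'] at h1 h2
  have h3 : (v i : ℝ) < w i + 1 := by linarith
  have h4 : (w i : ℝ) < v i + 1 := by linarith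
  have h5 : v i < w i + 1 := by exact_mod_cast h3
  have h6 : w i < v i + 1 := by exact_mod_cast h4
  omega

/-- The indices of the grid cells in the unit cube. -/
noncomputable def gridIndices (D k : ℕ) : Finset (Fin D → ℤ) :=
  Fintype.piFinset fun _ => Finset.Ico (0 : ℤ) k

theorem card_gridIndices (k : ℕ) : (gridIndices D k).card = k ^ D := by
  simp [gridIndices]

theorem mem_gridIndices {k : ℕ} {v : Fin D → ℤ} :
    v ∈ gridIndices D k ↔ ∀ i, 0 ≤ v i ∧ v i < k := by
  simp [gridIndices]

theorem cell_subset_cube {k : ℕ} {v : Fin D → ℤ} (hv : v ∈ gridIndices D k) :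
    cell k v ⊆ cube D 0 1 := by
  intro x hx i
  have h := mem_gridIndices.1 hv i
  have hk' : (0 : ℝ) < k := by exact_mod_cast h.1.trans_lt h.2
  have h1 := hx i
  simp only [Set.mem_Ico, div_le_iff₀ hk', lt_div_iff₀ hk'] at h1
  have h2 : (0 : ℝ) ≤ v i := by exact_mod_cast h.1
  have h3 : (v i : ℝ) + 1 ≤ k := by exact_mod_cast h.2
  constructor <;> nlinarith

theorem cellCore_subset_cell (k : ℕ) (v : Fin D → ℤ) : cellCore k v ⊆ cell k v := by
  intro x hx i
  have h1 := hx i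
  refine ⟨le_trans ?_ h1.1, lt_of_lt_of_le h1.2 ?_⟩
  · gcongr; linarith
  · gcongr; norm_num

/-- A point off the cell violates a bound in some coordinate, where the core keeps a margin of a
third of the width. -/
theorem le_dist_of_mem_cellCore {k : ℕ} (hk : 0 < k) {v : Fin D → ℤ} {x z : Pt D}
    (hx : x ∈ cellCore k v) (hz : z ∉ cell k v) : 1 / (3 * k) ≤ dist x z := by
  have hk' : (0 : ℝ) < k := by exact_mod_cast hk
  simp only [cell, Set.mem_ofPred_eq, not_forall, Set.mem_Ico, not_and_or, not_le, not_lt] at hz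
  obtain ⟨i, hi⟩ := hz
  refine le_trans ?_ (abs_sub_le_dist x z i)
  have h := hx i
  have e1 : ((v i : ℝ) + 1 / 3) / k = v i / k + 1 / (3 * k) := by ring
  have e2 : ((v i : ℝ) + 1) / k = (v i + 2 / 3) / k + 1 / (3 * k) := by ring
  rw [Set.mem_Ico, e1] at h
  rcases hi with hi | hi
  · exact le_trans (by linarith) (le_abs_self _)
  · rw [e2] at hi
    exact le_trans (by linarith) (neg_le_abs _)

/-- The indices of the grid cells in the unit cube which touch the face `x i₀ = 0`. -/
noncomputable def faceIndices (k : ℕ) (i₀ : Fin D) : Finset (Fin D → ℤ) :=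
  Fintype.piFinset fun i => if i = i₀ then {0} else Finset.Ico (0 : ℤ) k

theorem card_faceIndices (k : ℕ) (i₀ : Fin D) : (faceIndices k i₀).card = k ^ (D - 1) := by
  rw [faceIndices, Fintype.card_piFinset, ← Finset.mul_prod_erase _ _ (Finset.mem_univ i₀)]
  rw [Finset.prod_congr rfl (g := fun _ => k)]
  · simp
  · intro i hi
    simp [Finset.ne_of_mem_erase hi]

theorem faceIndices_subset {k : ℕ} (hk : 0 < k) (i₀ : Fin D) :
    faceIndices k i₀ ⊆ gridIndices D k := by
  refine Fintype.piFinset_subset _ _ fun i => ?_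
  split_ifs
  · simpa using hk
  · exact subset_rfl

theorem apply_eq_zero_of_mem_faceIndices {k : ℕ} {i₀ : Fin D} {v : Fin D → ℤ}
    (hv : v ∈ faceIndices k i₀) : v i₀ = 0 := by
  have := Fintype.mem_piFinset.1 hv i₀
  simpa using this

/-- The mirror image outside the unit cube of a cell which touches the face `x i₀ = 0`. -/
def outerCell (k : ℕ) (i₀ : Fin D) (v : Fin D → ℤ) : Set (Pt D) :=
  cell k (Function.update v i₀ (-1))

theorem outerCell_subset {k : ℕ} {i₀ : Fin D} {v : Fin D → ℤ} (hk : 0 < k)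
    (hv : v ∈ faceIndices k i₀) : outerCell k i₀ v ⊆ cube D (-1) 2 \ cube D 0 1 := by
  have hk' : (1 : ℝ) ≤ k := by exact_mod_cast hk
  have hk0 : (0 : ℝ) < k := by linarith
  intro x hx
  refine ⟨fun i => ?_, fun hc => ?_⟩
  · have h := hx i
    simp only [Set.mem_Ico, div_le_iff₀ hk0, lt_div_iff₀ hk0] at h
    by_cases hi : i = i₀
    · subst hi
      simp only [Function.update_self] at h
      push_cast at h
      constructor <;> nlinarith
    · rw [Function.update_of_ne hi] at h
      have hg := mem_gridIndices.1 (faceIndices_subset hk i₀ hv) i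
      have h2 : (0 : ℝ) ≤ v i := by exact_mod_cast hg.1
      have h3 : (v i : ℝ) + 1 ≤ k := by exact_mod_cast hg.2
      constructor <;> nlinarith
  -- The cell is half-open, so the coordinate `i₀` is strictly negative.
  · have h := (hx i₀).2
    have h0 := (hc i₀).1
    simp only [Function.update_self] at h
    push_cast at h
    norm_num at h
    linarith

/-- The coordinates `i₀` lie in adjacent intervals of length `1 / k`, the others in a common one. -/
theorem dist_le_of_mem_outerCell {k : ℕ} {i₀ : Fin D} {v : Fin D → ℤ}
    (hv : v ∈ faceIndices k i₀) {x z : Pt D} (hx : x ∈ outerCell k i₀ v) (hz : z ∈ cell k v) :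
    dist x z ≤ D * (2 / k) := by
  refine dist_le_of_forall_abs_sub_le (by positivity) fun i => ?_
  have h := hx i
  have h' := hz i
  have e : ∀ a : ℝ, (a + 1) / k = a / k + 1 / k := fun a => by ring
  have e2 : (2 : ℝ) / k = 1 / k + 1 / k := by ring
  have hk : (0 : ℝ) ≤ 1 / k := by positivity
  rw [Set.mem_Ico, e] at h h'
  rw [abs_le, e2]
  by_cases hi : i = i₀
  · subst hi
    simp only [Function.update_self, apply_eq_zero_of_mem_faceIndices hv] at h h'
    push_cast at h h'
    have e3 : (-1 : ℝ) / k = -(1 / k) := by ring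
    rw [e3] at h
    rw [zero_div] at h'
    constructor <;> linarith [h.1, h.2, h'.1, h'.2]
  · rw [Function.update_of_ne hi] at h
    constructor <;> linarith [h.1, h.2, h'.1, h'.2]

/-- Face indices all vanish at `i₀`, so overwriting that entry loses no information. -/
theorem pairwiseDisjoint_outerCell {k : ℕ} (hk : 0 < k) (i₀ : Fin D) :
    (faceIndices k i₀ : Set (Fin D → ℤ)).PairwiseDisjoint (outerCell k i₀) := by
  intro v hv w hw hvw
  refine disjoint_cell hk fun h => hvw (funext fun i => ?_)
  by_cases hi : i = i₀
  · subst hi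
    rw [apply_eq_zero_of_mem_faceIndices hv, apply_eq_zero_of_mem_faceIndices hw]
  · have := congrFun h i
    simpa [hi] using this

end Geometry

/-! ### Occupancy: moments of the number of empty cells -/

section Occupancy

variable {ι α E : Type*}

/-- The families for which no member with index in `S` lies in `T`. -/
def avoiding (S : Finset ι) (T : Set E) : Set (ι → E) := {x | ∀ i ∈ S, x i ∈ Tᶜ}

theorem avoiding_inter (S : Finset ι) (T U : Set E) :
    avoiding S T ∩ avoiding S U = avoiding S (T ∪ U) := by
  ext x
  simp only [avoiding, Set.mem_inter_iff, Set.mem_ofPred_eq, Set.compl_union, ← forall_and]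

/-- The number of the sets `T v` avoided by the members with index in `S`. -/
noncomputable def avoidedCount (S : Finset ι) (V : Finset α) (T : α → Set E) (x : ι → E) : ℝ :=
  ∑ v ∈ V, (avoiding S (T v)).indicator (fun _ => (1 : ℝ)) x

theorem avoidedCount_sq (S : Finset ι) (V : Finset α) (T : α → Set E) (x : ι → E) : avoidedCount S V T x ^ 2 =
    ∑ v ∈ V, ∑ w ∈ V, (avoiding S (T v ∪ T w)).indicator (fun _ => (1 : ℝ)) x := by
  rw [avoidedCount, sq, Finset.sum_mul_sum]
  refine Finset.sum_congr rfl fun v _ => Finset.sum_congr rfl fun w _ => ?_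
  rw [← avoiding_inter]
  by_cases h1 : x ∈ avoiding S (T v) <;> by_cases h2 : x ∈ avoiding S (T w) <;> simp [h1, h2]

variable [Fintype ι] [MeasurableSpace E] (μ : Measure E) [IsProbabilityMeasure μ]

theorem measurableSet_avoiding (S : Finset ι) {T : Set E} (hT : MeasurableSet T) :
    MeasurableSet (avoiding S T) := by
  simp only [avoiding, Set.ofPred_forall]
  exact MeasurableSet.iInter fun i => MeasurableSet.iInter fun _ => measurable_pi_apply i hT.compl

theorem measureReal_avoiding (S : Finset ι) {T : Set E} (hT : MeasurableSet T) :
    (Measure.pi fun _ : ι => μ).real (avoiding S T) = (1 - μ.real T) ^ S.card := by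
  rw [measureReal_def, avoiding, measure_pi_finset_pi μ S fun _ => Tᶜ, Finset.prod_const,
    ENNReal.toReal_pow, ← measureReal_def, probReal_compl_eq_one_sub hT]

variable {S : Finset ι} {V : Finset α} {T : α → Set E} {q : ℝ}

theorem integrable_indicator_avoiding (S : Finset ι) {T : Set E} (hT : MeasurableSet T) :
    Integrable ((avoiding S T).indicator fun _ => (1 : ℝ)) (Measure.pi fun _ : ι => μ) :=
  (integrable_const _).indicator (measurableSet_avoiding S hT)

theorem integral_indicator_avoiding (S : Finset ι) {T : Set E} (hT : MeasurableSet T) :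
    ∫ x, (avoiding S T).indicator (fun _ => (1 : ℝ)) x ∂(Measure.pi fun _ : ι => μ) =
      (1 - μ.real T) ^ S.card := by
  rw [integral_indicator (measurableSet_avoiding S hT), ← measureReal_avoiding μ S hT]
  simp

theorem integrable_avoidedCount (hT : ∀ v ∈ V, MeasurableSet (T v)) :
    Integrable (avoidedCount S V T) (Measure.pi fun _ : ι => μ) :=
  integrable_finsetSum _ fun v hv => integrable_indicator_avoiding μ S (hT v hv)

theorem integral_avoidedCount (hT : ∀ v ∈ V, MeasurableSet (T v)) (hq : ∀ v ∈ V, μ.real (T v) = q) :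
    ∫ x, avoidedCount S V T x ∂(Measure.pi fun _ : ι => μ) = V.card * (1 - q) ^ S.card := by
  simp only [avoidedCount]
  rw [integral_finsetSum _ fun v hv => integrable_indicator_avoiding μ S (hT v hv),
    Finset.sum_congr rfl fun v hv => by
      rw [integral_indicator_avoiding μ S (hT v hv), hq v hv]]
  simp

/-- The diagonal contributes the mean. Off the diagonal, disjointness and `1 - 2q ≤ (1 - q)^2` show
that avoidances are negatively correlated. -/
theorem integral_avoidedCount_sq_le (hT : ∀ v ∈ V, MeasurableSet (T v))
    (hq : ∀ v ∈ V, μ.real (T v) = q) (hdisj : (V : Set α).PairwiseDisjoint T) :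
    ∫ x, avoidedCount S V T x ^ 2 ∂(Measure.pi fun _ : ι => μ) ≤
      V.card * (1 - q) ^ S.card + (V.card * (1 - q) ^ S.card) ^ 2 := by
  classical
  have hint : ∀ v ∈ V, ∀ w ∈ V, Integrable
      ((avoiding S (T v ∪ T w)).indicator fun _ => (1 : ℝ)) (Measure.pi fun _ : ι => μ) :=
    fun v hv w hw => integrable_indicator_avoiding μ S ((hT v hv).union (hT w hw))
  simp only [avoidedCount_sq]
  rw [integral_finsetSum _ fun v hv => integrable_finsetSum _ fun w hw => hint v hv w hw]
  have hterm : ∀ v ∈ V, ∀ w ∈ V,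
      ∫ x, (avoiding S (T v ∪ T w)).indicator (fun _ => (1 : ℝ)) x
        ∂(Measure.pi fun _ : ι => μ) ≤
      (if v = w then (1 - q) ^ S.card else 0) + ((1 - q) ^ S.card) ^ 2 := by
    intro v hv w hw
    rw [integral_indicator_avoiding μ S ((hT v hv).union (hT w hw))]
    by_cases h : v = w
    · subst h
      simp only [Set.union_self, hq v hv, if_true]
      exact le_add_of_nonneg_right (sq_nonneg _)
    · have hu : μ.real (T v ∪ T w) = 2 * q := by
        rw [measureReal_union (hdisj hv hw h) (hT w hw), hq v hv, hq w hw]; ring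
      -- This makes the base `1 - 2q` nonnegative, as monotonicity of powers needs.
      have hle : μ.real (T v ∪ T w) ≤ 1 := measureReal_le_one
      rw [hu] at hle ⊢
      rw [if_neg h, zero_add, ← pow_mul, mul_comm S.card 2, pow_mul]
      exact pow_le_pow_left₀ (by linarith) (by nlinarith [sq_nonneg q]) _
  calc _ ≤ ∑ v ∈ V, ∑ w ∈ V,
        ((if v = w then (1 - q) ^ S.card else 0) + ((1 - q) ^ S.card) ^ 2) := by
        refine Finset.sum_le_sum fun v hv => ?_
        rw [integral_finsetSum _ fun w hw => hint v hv w hw]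
        exact Finset.sum_le_sum fun w hw => hterm v hv w hw
    _ = _ := by
        simp only [Finset.sum_add_distrib, Finset.sum_ite_eq, Finset.sum_const, nsmul_eq_mul]
        rw [Finset.sum_congr rfl fun v hv => if_pos hv]
        simp only [Finset.sum_const, nsmul_eq_mul]
        ring

/-- Second moment bound for the probability that none of the sets is avoided. -/
theorem measureReal_forall_not_avoiding_le (hT : ∀ v ∈ V, MeasurableSet (T v))
    (hq : ∀ v ∈ V, μ.real (T v) = q) (hdisj : (V : Set α).PairwiseDisjoint T)
    (hpos : 0 < V.card * (1 - q) ^ S.card) :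
    (Measure.pi fun _ : ι => μ).real {x | ∀ v ∈ V, x ∉ avoiding S (T v)} ≤
      1 / (V.card * (1 - q) ^ S.card) := by
  set e : ℝ := V.card * (1 - q) ^ S.card with he
  set B : Set (ι → E) := {x | ∀ v ∈ V, x ∉ avoiding S (T v)} with hB
  have hBm : MeasurableSet B := by
    have : B = ⋂ v ∈ V, (avoiding S (T v))ᶜ := by ext; simp [hB]
    rw [this]
    exact V.measurableSet_biInter fun v hv => (measurableSet_avoiding S (hT v hv)).compl
  have hY := integrable_avoidedCount μ (S := S) hT
  have hY2 : Integrable (fun x => avoidedCount S V T x ^ 2) (Measure.pi fun _ : ι => μ) := by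
    simp only [avoidedCount_sq]
    exact integrable_finsetSum _ fun v hv => integrable_finsetSum _ fun w hw =>
      integrable_indicator_avoiding μ S ((hT v hv).union (hT w hw))
  have hint : Integrable (fun x => avoidedCount S V T x ^ 2 - 2 * e * avoidedCount S V T x + e ^ 2)
      (Measure.pi fun _ : ι => μ) := (hY2.sub (hY.const_mul _)).add (integrable_const _)
  -- Chebyshev: on `B` the count is zero, so its squared deviation from the mean `e` is `e ^ 2`,
  -- whereas the variance is at most `e`.
  have h1 : (Measure.pi fun _ : ι => μ).real B * e ^ 2 ≤
      ∫ x, (avoidedCount S V T x ^ 2 - 2 * e * avoidedCount S V T x + e ^ 2)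
        ∂(Measure.pi fun _ : ι => μ) := by
    calc (Measure.pi fun _ : ι => μ).real B * e ^ 2
        = ∫ x, B.indicator (fun _ => e ^ 2) x ∂(Measure.pi fun _ : ι => μ) := by
          rw [integral_indicator hBm]; simp
      _ ≤ _ := by
          refine integral_mono ((integrable_const _).indicator hBm) hint fun x => ?_
          by_cases hx : x ∈ B
          · have : avoidedCount S V T x = 0 :=
              Finset.sum_eq_zero fun v hv => by simp [hx v hv]
            simp [hx, this]
          · simp only [hx, Set.indicator_of_notMem, not_false_eq_true]
            nlinarith [sq_nonneg (avoidedCount S V T x - e)]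
  rw [integral_add (f := fun x => avoidedCount S V T x ^ 2 - 2 * e * avoidedCount S V T x)
      (g := fun _ => e ^ 2) (hY2.sub (hY.const_mul _)) (integrable_const _),
    integral_sub hY2 (hY.const_mul _), integral_const_mul, integral_avoidedCount μ hT hq,
    integral_const, ← he] at h1
  have h2 := integral_avoidedCount_sq_le μ (S := S) hT hq hdisj
  rw [← he] at h2
  simp only [probReal_univ, one_smul] at h1
  rw [le_div_iff₀ hpos]
  have h3 : ((Measure.pi fun _ : ι => μ).real B * e) * e ≤ 1 * e := by nlinarith
  exact le_of_mul_le_mul_right h3 hpos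

/-- First moment bound for the probability that half of the sets are avoided. -/
theorem measureReal_half_le_avoidedCount_le (hT : ∀ v ∈ V, MeasurableSet (T v))
    (hq : ∀ v ∈ V, μ.real (T v) = q) (hV : 0 < V.card) :
    (Measure.pi fun _ : ι => μ).real {x | (V.card : ℝ) / 2 ≤ avoidedCount S V T x} ≤
      2 * (1 - q) ^ S.card := by
  have hV' : (0 : ℝ) < V.card := by exact_mod_cast hV
  have h := mul_meas_ge_le_integral_of_nonneg (μ := Measure.pi fun _ : ι => μ)
    (f := avoidedCount S V T) (Filter.Eventually.of_forall fun x =>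
      Finset.sum_nonneg fun v _ => Set.indicator_nonneg (fun _ _ => zero_le_one) x)
    (integrable_avoidedCount μ (S := S) hT) (V.card / 2)
  rw [integral_avoidedCount μ hT hq] at h
  have h2 : (V.card : ℝ) * ((Measure.pi fun _ : ι => μ).real
      {x | (V.card : ℝ) / 2 ≤ avoidedCount S V T x}) ≤ V.card * (2 * (1 - q) ^ S.card) := by
    linarith
  exact le_of_mul_le_mul_left h2 hV'

end Occupancy

/-! ### An empty cell forces queries in a shell outside the cube -/

section Uncovered

variable {D n : ℕ}

theorem dist_ge_infEDist_cellCore {k : ℕ} (hk : 0 < k) {v : Fin D → ℤ} {S : Finset (Fin n)}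
    {x : Fin n → Pt D × Bool} (hx : x ∈ avoiding S (cell k v ×ˢ {true})) {h : Pt D}
    (hh : h ∈ cellCore k v) :
    ENNReal.ofReal (1 / (3 * k)) ≤ Metric.infEDist h (initialPositives (S, x)) := by
  refine Metric.le_infEDist.2 ?_
  rintro _ ⟨i, hi, hl, rfl⟩
  rw [edist_dist]
  refine ENNReal.ofReal_le_ofReal (le_dist_of_mem_cellCore hk hh fun hc => ?_)
  exact hx i hi (Set.mem_prod.2 ⟨hc, hl⟩)

theorem infEDist_outerCell_le {k : ℕ} {i₀ : Fin D} {v : Fin D → ℤ} (hv : v ∈ faceIndices k i₀)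
    {S : Finset (Fin n)} {x : Fin n → Pt D × Bool} (hx : x ∉ avoiding S (cell k v ×ˢ {true}))
    {w : Pt D} (hw : w ∈ outerCell k i₀ v) :
    Metric.infEDist w (initialPositives (S, x)) ≤ ENNReal.ofReal (D * (2 / k)) := by
  simp only [avoiding, Set.mem_ofPred_eq, not_forall, Set.mem_compl_iff, not_not] at hx
  obtain ⟨i, hi, hxi⟩ := hx
  have hmem : (x i).1 ∈ initialPositives (S, x) := ⟨i, hi, hxi.2, rfl⟩
  refine (Metric.infEDist_le_edist_of_mem hmem).trans ?_
  rw [edist_dist]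
  exact ENNReal.ofReal_le_ofReal (dist_le_of_mem_outerCell hv hw hxi.1)

open Classical in
/-- The points outside the unit cube near the occupied cells along a face. -/
noncomputable def shell (k : ℕ) (i₀ : Fin D) (S : Finset (Fin n)) (x : Fin n → Pt D × Bool) :
    Set (Pt D) :=
  ⋃ v ∈ (faceIndices k i₀).filter fun v => x ∉ avoiding S (cell k v ×ˢ {true}), outerCell k i₀ v

theorem measurableSet_shell (k : ℕ) (i₀ : Fin D) (S : Finset (Fin n)) (x : Fin n → Pt D × Bool) :
    MeasurableSet (shell k i₀ S x) :=
  Finset.measurableSet_biUnion _ fun _ _ => measurableSet_cell _ _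

theorem shell_subset {k : ℕ} (hk : 0 < k) (i₀ : Fin D) (S : Finset (Fin n))
    (x : Fin n → Pt D × Bool) : shell k i₀ S x ⊆ cube D (-1) 2 \ cube D 0 1 := by
  classical
  exact Set.iUnion₂_subset fun _ hv => outerCell_subset hk (Finset.mem_filter.1 hv).1

/-- More than half of the `k ^ (D - 1)` face cells are occupied, and their mirror images are
disjoint, of volume `k ^ (-D)` each. -/
theorem le_volume_shell {k : ℕ} (hk : 0 < k) (i₀ : Fin D) {S : Finset (Fin n)}
    {x : Fin n → Pt D × Bool}
    (hx : avoidedCount S (faceIndices k i₀) (fun v => cell k v ×ˢ {true}) x <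
      ((faceIndices k i₀).card : ℝ) / 2) :
    1 / (2 * k) ≤ volume.real (shell k i₀ S x) := by
  classical
  have hk' : (0 : ℝ) < k := by exact_mod_cast hk
  have hcount : avoidedCount S (faceIndices k i₀) (fun v => cell k v ×ˢ {true}) x =
      ((faceIndices k i₀).filter fun v => x ∈ avoiding S (cell k v ×ˢ {true})).card := by
    rw [avoidedCount, Finset.card_filter]
    push_cast
    exact Finset.sum_congr rfl fun v _ => by simp [Set.indicator_apply]
  have hsplit := Finset.card_filter_add_card_filter_not (s := faceIndices k i₀)
    fun v => x ∈ avoiding S (cell k v ×ˢ {true})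
  have hsplit' : (((faceIndices k i₀).filter fun v => x ∈ avoiding S (cell k v ×ˢ {true})).card : ℝ)
      + ((faceIndices k i₀).filter fun v => x ∉ avoiding S (cell k v ×ˢ {true})).card =
      (faceIndices k i₀).card := by exact_mod_cast hsplit
  have hvol : volume.real (shell k i₀ S x) =
      ((faceIndices k i₀).filter fun v => x ∉ avoiding S (cell k v ×ˢ {true})).card *
        (1 / k : ℝ) ^ D := by
    rw [measureReal_def, shell, measure_biUnion_finset
      ((pairwiseDisjoint_outerCell hk i₀).subset (by
        intro v hv; exact (Finset.mem_filter.1 hv).1)) fun v _ => measurableSet_cell _ _]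
    simp only [outerCell, volume_cell, Finset.sum_const, nsmul_eq_mul]
    rw [ENNReal.toReal_mul, ENNReal.toReal_ofReal (by positivity), ENNReal.toReal_natCast]
  rw [hvol]
  rw [hcount] at hx
  have hM : ((faceIndices k i₀).card : ℝ) * (1 / k : ℝ) ^ D = 1 / k := by
    rw [card_faceIndices]
    have hD : D = D - 1 + 1 := by have := i₀.pos; omega
    conv_lhs => rw [hD]
    rw [Nat.add_sub_cancel, pow_succ, ← mul_assoc]
    push_cast
    rw [← mul_pow, mul_one_div_cancel hk'.ne', one_pow, one_mul]
  calc 1 / (2 * k : ℝ) = ((faceIndices k i₀).card : ℝ) / 2 * (1 / k : ℝ) ^ D := by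
        rw [div_mul_eq_mul_div, hM]; field_simp
    _ ≤ _ := by
        refine mul_le_mul_of_nonneg_right ?_ (by positivity)
        linarith

open Classical in
/-- The lower bound on the expected excess cost fails with small probability. -/
theorem measureReal_integral_excessCost_lt_le (i₀ : Fin D) (μ : Measure (Pt D × Bool))
    [IsProbabilityMeasure μ] {p c : ℝ} {κ : NNReal} (hp0 : 0 < p) (hp1 : p < 1) (hc : 0 ≤ c)
    (hpos : ∀ A ⊆ cube D 0 1, MeasurableSet A → μ.real (A ×ˢ {true}) = p * volume.real A)
    (hout : ∀ A ⊆ cube D (-1) 2 \ cube D 0 1, MeasurableSet A →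
      c * volume.real A ≤ μ.real (A ×ˢ Set.univ))
    (hκ : ∀ F : Set (Pt D), MeasurableSet F →
      μ ((F ∩ cube D 0 1) ×ˢ {false}) ≤ κ * μ (F ×ˢ {true}))
    {k : ℕ} (hk : 0 < k) (S : Finset (Fin n)) :
    (Measure.pi fun _ => μ).real {x | ¬
      (((S.filter fun i => (x i).1 ∉ cube D 0 1).card : ℝ) +
        Sᶜ.card * (c * (1 / (14 * D * k)) *
          (1 - (1 - p * (1 / (3 * k)) ^ D) ^ (Sᶜ.card - 1))) - κ ≤
      ∫ y, excessCost (uniformDist (cube D 0 1)) (S, merge S x y) ∂Measure.pi fun _ => μ)} ≤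
    1 / (k ^ D * (1 - p * (1 / k) ^ D) ^ S.card) +
      2 * (1 - p * (1 / (7 * D * k)) ^ D) ^ S.card := by
  have hD : 0 < D := i₀.pos
  have hk' : (0 : ℝ) < k := by exact_mod_cast hk
  -- The refinement `7 * D` brings the shell within `D * 2 / (7 D k) = 2 / (7 k)` of the initial
  -- positives, below the distance `1 / (3 k)` of the core of an empty cell.
  have hK : 0 < 7 * D * k := by positivity
  have hT : ∀ k (v : Fin D → ℤ), MeasurableSet (cell k v ×ˢ ({true} : Set Bool)) :=
    fun k v => (measurableSet_cell k v).prod (measurableSet_singleton _)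
  have hq : ∀ k, ∀ v ∈ gridIndices D k, μ.real (cell k v ×ˢ {true}) = p * (1 / k) ^ D := by
    intro k v hv
    rw [hpos _ (cell_subset_cube hv) (measurableSet_cell k v), measureReal_def, volume_cell,
      ENNReal.toReal_ofReal (by positivity)]
  have hk1 : (1 / k : ℝ) ^ D ≤ 1 := by
    refine pow_le_one₀ (by positivity) ?_
    rw [div_le_one hk']
    exact_mod_cast hk
  -- The two bad events: no coarse cell is empty (`B₁`), or at least half of the fine face cells are
  -- empty (`B₂`).
  set B₁ : Set (Fin n → Pt D × Bool) :=
    {x | ∀ v ∈ gridIndices D k, x ∉ avoiding S (cell k v ×ˢ {true})}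
  set B₂ : Set (Fin n → Pt D × Bool) :=
    {x | ((faceIndices (7 * D * k) i₀).card : ℝ) / 2 ≤
      avoidedCount S (faceIndices (7 * D * k) i₀) (fun v => cell (7 * D * k) v ×ˢ {true}) x}
  have h1 : (Measure.pi fun _ => μ).real B₁ ≤ 1 / (k ^ D * (1 - p * (1 / k) ^ D) ^ S.card) := by
    have := measureReal_forall_not_avoiding_le μ (S := S) (V := gridIndices D k)
      (T := fun v => cell k v ×ˢ {true}) (fun v _ => hT k v) (hq k)
      (fun v _ w _ hvw => Set.disjoint_left.2 fun a ha ha' =>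
        Set.disjoint_left.1 (disjoint_cell hk hvw) ha.1 ha'.1) (by
        rw [card_gridIndices]
        have : 0 < 1 - p * (1 / k : ℝ) ^ D := by nlinarith [show (0 : ℝ) < (1 / k) ^ D by positivity]
        push_cast
        positivity)
    rw [card_gridIndices] at this
    push_cast at this
    exact this
  have h2 : (Measure.pi fun _ => μ).real B₂ ≤ 2 * (1 - p * (1 / (7 * D * k)) ^ D) ^ S.card := by
    have := measureReal_half_le_avoidedCount_le μ (S := S) (V := faceIndices (7 * D * k) i₀)
      (T := fun v => cell (7 * D * k) v ×ˢ {true}) (fun v _ => hT _ v)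
      (fun v hv => hq _ v (faceIndices_subset hK i₀ hv))
      (by rw [card_faceIndices]; positivity)
    push_cast at this
    exact this
  refine le_trans (measureReal_mono ?_) ((measureReal_union_le B₁ B₂).trans (add_le_add h1 h2))
  intro x hx
  by_contra hB
  simp only [Set.mem_union, not_or] at hB
  obtain ⟨hB1, hB2⟩ := hB
  apply hx
  simp only [B₁, Set.mem_ofPred_eq, not_forall, not_not] at hB1
  obtain ⟨v, hv, hvx⟩ := hB1
  simp only [B₂, Set.mem_ofPred_eq, not_le] at hB2
  have hW := measurableSet_shell (7 * D * k) i₀ S x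
  have hWs := shell_subset hK i₀ S x
  have hcore : μ.real (cellCore k v ×ˢ {true}) = p * (1 / (3 * k)) ^ D := by
    rw [hpos _ ((cellCore_subset_cell k v).trans (cell_subset_cube hv))
      (measurableSet_cellCore k v), measureReal_def, volume_cellCore,
      ENNReal.toReal_ofReal (by positivity)]
  have hWv : c * (1 / (14 * D * k)) ≤ μ.real (shell (7 * D * k) i₀ S x ×ˢ Set.univ) := by
    refine le_trans (mul_le_mul_of_nonneg_left ?_ hc) (hout _ hWs hW)
    refine le_trans (le_of_eq ?_) (le_volume_shell hK i₀ hB2)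
    push_cast
    ring
  have hmain := le_integral_excessCost (uniformDist (cube D 0 1)) μ S x (κ := κ)
    (W := shell (7 * D * k) i₀ S x) (H := cellCore k v)
    (by rw [support_uniformDist_unitCube]; exact hκ) hW (measurableSet_cellCore k v)
    (by
      rw [support_uniformDist_unitCube]
      exact Set.disjoint_left.2 fun w hw => (hWs hw).2)
    (by
      intro w hw h hh
      obtain ⟨u, hu, hwu⟩ := Set.mem_iUnion₂.1 hw
      have hu' := Finset.mem_filter.1 hu
      refine (infEDist_outerCell_le hu'.1 hu'.2 hwu).trans_lt
        (lt_of_lt_of_le ?_ (dist_ge_infEDist_cellCore hk hvx hh))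
      rw [ENNReal.ofReal_lt_ofReal_iff (by positivity)]
      push_cast
      have hD' : (0 : ℝ) < D := by exact_mod_cast hD
      have e : (D : ℝ) * (2 / (7 * D * k)) = (2 / 7) * (1 / k) := by field_simp
      have e2 : 1 / (3 * (k : ℝ)) = (1 / 3) * (1 / k) := by field_simp
      rw [e, e2]
      exact mul_lt_mul_of_pos_right (by norm_num) (by positivity))
  rw [hcore] at hmain
  simp only [support_uniformDist_unitCube] at hmain
  refine le_trans ?_ hmain
  -- The hitting probability is nonnegative, so the shell mass may be replaced by its lower bound.
  have hpow : (1 - p * (1 / (3 * k : ℝ)) ^ D) ^ (Sᶜ.card - 1) ≤ 1 := by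
    have h3 : (1 / (3 * k : ℝ)) ^ D ≤ 1 := by
      refine pow_le_one₀ (by positivity) ?_
      rw [div_le_one (by positivity)]
      have : (1 : ℝ) ≤ k := by exact_mod_cast hk
      linarith
    have h4 : (0 : ℝ) < (1 / (3 * k : ℝ)) ^ D := by positivity
    exact pow_le_one₀ (by nlinarith) (by nlinarith)
  gcongr

end Uncovered

/-! ### Choice of the grid width and asymptotic estimates -/

section Asymptotics

theorem rate_le_one (D : ℕ) {m : ℕ} (hm : 1 ≤ m) : rate D m ≤ 1 := by
  have hm' : (0 : ℝ) < m := by exact_mod_cast hm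
  refine Real.rpow_le_one (div_nonneg (Real.log_natCast_nonneg m) hm'.le) ?_ (by positivity)
  rw [div_le_one hm']
  exact Real.log_le_self hm'.le

theorem rate_nonneg (D m : ℕ) : 0 ≤ rate D m :=
  Real.rpow_nonneg (div_nonneg (Real.log_natCast_nonneg m) (Nat.cast_nonneg m)) _

/-- A grid whose cells have volume of order `log m / m`. -/
theorem exists_grid_width {D m : ℕ} (hD : 1 ≤ D) (hm : 1 ≤ Real.log m) :
    ∃ k : ℕ, 0 < k ∧ (1 / k : ℝ) ^ D ≤ Real.log m / (4 * m) ∧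
      Real.log m / (2 ^ D * (4 * m)) ≤ (1 / k : ℝ) ^ D ∧ rate D m / 8 ≤ 1 / k := by
  have hm0 : (0 : ℝ) < m := by
    rcases Nat.eq_zero_or_pos m with rfl | h
    · simp at hm; linarith
    · exact_mod_cast h
  have hlog : 0 < Real.log m := by linarith
  have hlm : Real.log m ≤ m := Real.log_le_self hm0.le
  have hD0 : (D : ℝ) ≠ 0 := by positivity
  set b : ℝ := m / Real.log m with hb
  have hb1 : 1 ≤ b := by rw [hb, le_div_iff₀ hlog]; linarith
  have hb0 : 0 < b := by linarith
  -- The exact width would be `1 / t`. Since `t ≥ 1`, rounding up to `k = ⌈t⌉₊` at most doubles it,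
  -- and with `4 ^ (1 / D) ≤ 4` this gives the factor `8`.
  set t : ℝ := (4 * b) ^ (1 / (D : ℝ)) with ht
  have ht1 : 1 ≤ t := Real.one_le_rpow (by linarith) (by positivity)
  have htD : t ^ D = 4 * b := by
    rw [ht, ← Real.rpow_natCast, ← Real.rpow_mul (by positivity), one_div_mul_cancel hD0,
      Real.rpow_one]
  have ht0 : 0 < t := by linarith
  have hk1 : t ≤ ⌈t⌉₊ := Nat.le_ceil t
  have hk2 : (⌈t⌉₊ : ℝ) ≤ 2 * t := by
    have := Nat.ceil_lt_add_one ht0.le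
    linarith
  have hk0 : (0 : ℝ) < ⌈t⌉₊ := by linarith
  refine ⟨⌈t⌉₊, by exact_mod_cast hk0, ?_, ?_, ?_⟩
  · calc (1 / ⌈t⌉₊ : ℝ) ^ D ≤ (1 / t) ^ D := by gcongr
      _ = Real.log m / (4 * m) := by
        rw [one_div, inv_pow, htD, hb]; field_simp
  · calc Real.log m / (2 ^ D * (4 * m)) = (1 / (2 * t)) ^ D := by
          rw [one_div, inv_pow, mul_pow, htD, hb]; field_simp
      _ ≤ (1 / ⌈t⌉₊ : ℝ) ^ D := by gcongr
  · have h4 : (4 : ℝ) ^ (1 / (D : ℝ)) ≤ 4 := by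
      refine (Real.rpow_le_rpow_of_exponent_le (by norm_num) ?_).trans_eq (Real.rpow_one 4)
      rw [div_le_one (by positivity)]
      exact_mod_cast hD
    have hr : rate D m = (b ^ (1 / (D : ℝ)))⁻¹ := by
      rw [rate, ← Real.inv_rpow hb0.le, hb, inv_div]
    have hbp : 0 < b ^ (1 / (D : ℝ)) := by positivity
    have ht2 : t ≤ 4 * b ^ (1 / (D : ℝ)) := by
      rw [ht, Real.mul_rpow (by norm_num) hb0.le]
      gcongr
    calc rate D m / 8 = 1 / (2 * (4 * b ^ (1 / (D : ℝ)))) := by rw [hr]; field_simp; norm_num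
      _ ≤ 1 / (2 * t) := by gcongr
      _ ≤ 1 / ⌈t⌉₊ := by gcongr

/-- Uses `exp (2u) ≥ 1 + 2u` and `(1 + 2u)(1 - u) = 1 + u (1 - 2u) ≥ 1`. -/
theorem exp_neg_two_mul_le_one_sub {u : ℝ} (hu0 : 0 ≤ u) (hu : u ≤ 1 / 2) :
    Real.exp (-(2 * u)) ≤ 1 - u := by
  have h1 : 1 + 2 * u ≤ Real.exp (2 * u) := by linarith [Real.add_one_le_exp (2 * u)]
  rw [Real.exp_neg]
  calc (Real.exp (2 * u))⁻¹ ≤ (1 + 2 * u)⁻¹ := by gcongr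
    _ ≤ 1 - u := by
      rw [inv_le_iff_one_le_mul₀ (by positivity)]
      nlinarith

theorem one_sub_pow_le_exp {u : ℝ} (hu : u ≤ 1) (N : ℕ) : (1 - u) ^ N ≤ Real.exp (-(N * u)) := by
  calc (1 - u) ^ N ≤ Real.exp (-u) ^ N :=
        pow_le_pow_left₀ (by linarith) (by linarith [Real.add_one_le_exp (-u)]) N
    _ = Real.exp (-(N * u)) := by rw [← Real.exp_nat_mul]; congr 1; ring

/-- The expected number of empty cells is large. -/
theorem rpow_le_mul_one_sub_pow {m : ℕ} (hm : 1 ≤ Real.log m) {p a : ℝ} (hp0 : 0 ≤ p)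
    (hp1 : p ≤ 1) (ha0 : 0 < a) (ha : a ≤ Real.log m / (4 * m)) :
    (m : ℝ) ^ (1 / 4 : ℝ) ≤ a⁻¹ * (1 - p * a) ^ m := by
  have hm0 : (0 : ℝ) < m := by
    rcases Nat.eq_zero_or_pos m with rfl | h
    · simp at hm; linarith
    · exact_mod_cast h
  have hlog : 0 < Real.log m := by linarith
  have hlm : Real.log m ≤ m := Real.log_le_self hm0.le
  have ham : a * (4 * m) ≤ Real.log m := (le_div_iff₀ (by positivity)).1 ha
  have ha4 : a ≤ 1 / 4 := by nlinarith
  have hpa : p * a ≤ a := by nlinarith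
  -- Here `2 p a m ≤ 2 a m ≤ log m / 2`.
  have h1 : (m : ℝ) ^ (-(1 / 2) : ℝ) ≤ (1 - p * a) ^ m := by
    calc (m : ℝ) ^ (-(1 / 2) : ℝ) = Real.exp (-(1 / 2) * Real.log m) := by
          rw [Real.rpow_def_of_pos hm0, mul_comm]
      _ ≤ Real.exp (m * (-(2 * (p * a)))) := by
          refine Real.exp_le_exp.2 ?_
          nlinarith
      _ = Real.exp (-(2 * (p * a))) ^ m := Real.exp_nat_mul _ _
      _ ≤ (1 - p * a) ^ m :=
          pow_le_pow_left₀ (Real.exp_pos _).le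
            (exp_neg_two_mul_le_one_sub (by positivity) (by linarith)) m
  -- From `a⁻¹ ≥ 4 m / log m` and `log m ≤ 4 m ^ (1/4)`.
  have h2 : (m : ℝ) ^ (3 / 4 : ℝ) ≤ a⁻¹ := by
    have h3 := Real.log_le_rpow_div hm0.le (ε := 1 / 4) (by norm_num)
    rw [le_inv_comm₀ (by positivity) ha0]
    have h4 : (m : ℝ) = (m : ℝ) ^ (3 / 4 : ℝ) * (m : ℝ) ^ (1 / 4 : ℝ) := by
      rw [← Real.rpow_add hm0]; norm_num
    have h5 : 0 < (m : ℝ) ^ (3 / 4 : ℝ) := by positivity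
    have h6 : 0 < (m : ℝ) ^ (1 / 4 : ℝ) := by positivity
    refine le_of_mul_le_mul_right (a := 4 * (m : ℝ)) ?_ (by positivity)
    calc a * (4 * m) ≤ Real.log m := ham
      _ ≤ 4 * (m : ℝ) ^ (1 / 4 : ℝ) := by linarith
      _ = ((m : ℝ) ^ (3 / 4 : ℝ))⁻¹ * (4 * m) := by
        conv_rhs => rw [h4]
        rw [Real.mul_rpow h5.le h6.le, ← Real.rpow_mul hm0.le, ← Real.rpow_mul hm0.le,
          ← Real.rpow_add hm0]
        rw [show (3 / 4 * (3 / 4) + 1 / 4 * (3 / 4) : ℝ) = 3 / 4 by norm_num]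
        field_simp
  calc (m : ℝ) ^ (1 / 4 : ℝ) = (m : ℝ) ^ (3 / 4 : ℝ) * (m : ℝ) ^ (-(1 / 2) : ℝ) := by
        rw [← Real.rpow_add hm0]; norm_num
    _ ≤ a⁻¹ * (1 - p * a) ^ m := by gcongr

-- At cell volume of order `log m / m`, each of the two bad events has probability at most `1/16`
-- for large `m`, and the core of the empty cell is hit with probability at least `1/2`.
open Classical in
theorem exists_forall_measureReal_excessCost_lt_le {D : ℕ} (hD : 1 ≤ D)
    (μ : Measure (Pt D × Bool))
    [IsProbabilityMeasure μ] {p c : ℝ} {κ : NNReal} (hp0 : 0 < p) (hp1 : p < 1) (hc : 0 < c)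
    (hpos : ∀ A ⊆ cube D 0 1, MeasurableSet A → μ.real (A ×ˢ {true}) = p * volume.real A)
    (hout : ∀ A ⊆ cube D (-1) 2 \ cube D 0 1, MeasurableSet A →
      c * volume.real A ≤ μ.real (A ×ˢ Set.univ))
    (hκ : ∀ F : Set (Pt D), MeasurableSet F →
      μ ((F ∩ cube D 0 1) ×ˢ {false}) ≤ κ * μ (F ×ˢ {true})) {θ : ℝ} (hθ : θ < 1) :
    ∃ C : ℝ, 0 < C ∧ ∃ N : ℕ, ∀ n m : ℕ, N ≤ m → (m : ℝ) ≤ θ * n →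
      ∀ S : Finset (Fin n), S.card = m →
      (Measure.pi fun _ => μ).real {x | ¬
        (((S.filter fun i => (x i).1 ∉ cube D 0 1).card : ℝ) + C * rate D m * n - κ ≤
        ∫ y, excessCost (uniformDist (cube D 0 1)) (S, merge S x y) ∂Measure.pi fun _ => μ)} ≤
      1 / 8 := by
  have hD0 : (0 : ℝ) < D := by exact_mod_cast hD
  have hθ' : 0 < 1 - θ := by linarith
  -- The expected number of initial positives in a fine face cell is at least `a₁ * log m`; that of
  -- positives in a core, among `Sᶜ.card - 1` remaining examples, is at least `a₂ * log m`.
  set a₁ : ℝ := p * (1 / (7 * D)) ^ D / (2 ^ D * 4) with ha₁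
  set a₂ : ℝ := p * (1 / 3) ^ D * ((1 - θ) / 2) / (2 ^ D * 4) with ha₂
  have ha₁0 : 0 < a₁ := by positivity
  have ha₂0 : 0 < a₂ := by positivity
  have hcast : Filter.Tendsto (fun m : ℕ => (m : ℝ)) Filter.atTop Filter.atTop :=
    tendsto_natCast_atTop_atTop
  have hlogt := Real.tendsto_log_atTop.comp hcast
  have hev : ∀ᶠ m : ℕ in Filter.atTop, 1 ≤ Real.log m ∧ 4 / a₁ ≤ Real.log m ∧
      1 / a₂ ≤ Real.log m ∧ 16 ≤ (m : ℝ) ^ (1 / 4 : ℝ) ∧ 2 / (1 - θ) ≤ m :=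
    (hlogt.eventually_ge_atTop 1).and ((hlogt.eventually_ge_atTop _).and
      ((hlogt.eventually_ge_atTop _).and
        ((((tendsto_rpow_atTop (by norm_num)).comp hcast).eventually_ge_atTop 16).and
          (hcast.eventually_ge_atTop _))))
  obtain ⟨N, hN⟩ := Filter.eventually_atTop.1 hev
  -- `224 = 14 * 8 * 2`: shell volume `1 / (14 D k)`, width `1 / k ≥ rate D m / 8`, hitting
  -- probability `1/2`; and at least `(1 - θ) n` examples remain.
  refine ⟨c * (1 - θ) / (224 * D), by positivity, N, fun n m hm hmn S hS => ?_⟩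
  obtain ⟨h1, h2, h3, h4, h5⟩ := hN m hm
  obtain ⟨k, hk, hk1, hk2, hk3⟩ := exists_grid_width hD h1
  have hk' : (0 : ℝ) < k := by exact_mod_cast hk
  have hm0 : (0 : ℝ) < m := lt_of_lt_of_le (by positivity) h5
  have hlog : 0 < Real.log m := by linarith
  have hSc : (Sᶜ.card : ℝ) = n - m := by
    have := Finset.card_add_card_compl S
    rw [hS, Fintype.card_fin] at this
    rw [eq_sub_iff_add_eq, add_comm]
    exact_mod_cast this
  have hmn' : (m : ℝ) ≤ n := by
    have : (0 : ℝ) ≤ Sᶜ.card := Nat.cast_nonneg _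
    linarith
  have hScn : (1 - θ) * n ≤ Sᶜ.card := by rw [hSc]; linarith
  -- Halving `1 - θ` pays for the missing example, since `(1 - θ) m ≥ 2`.
  have hScm : (1 - θ) / 2 * m ≤ ((Sᶜ.card - 1 : ℕ) : ℝ) := by
    have e1 : (Sᶜ.card : ℝ) - 1 ≤ ((Sᶜ.card - 1 : ℕ) : ℝ) := by
      rw [sub_le_iff_le_add]
      have : Sᶜ.card ≤ Sᶜ.card - 1 + 1 := by omega
      exact_mod_cast this
    have e2 : 2 ≤ m * (1 - θ) := (div_le_iff₀ hθ').1 h5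
    nlinarith
  have hbound := measureReal_integral_excessCost_lt_le ⟨0, hD⟩ μ hp0 hp1 hc.le hpos hout hκ hk S
  have hempty : 1 / ((k : ℝ) ^ D * (1 - p * (1 / k) ^ D) ^ S.card) ≤ 1 / 16 := by
    have := rpow_le_mul_one_sub_pow h1 hp0.le hp1.le (a := (1 / k : ℝ) ^ D) (by positivity) hk1
    rw [show ((1 / k : ℝ) ^ D)⁻¹ = (k : ℝ) ^ D by rw [one_div, inv_pow, inv_inv]] at this
    rw [hS]
    exact one_div_le_one_div_of_le (by norm_num) (h4.trans this)
  have hface : 2 * (1 - p * (1 / (7 * D * k) : ℝ) ^ D) ^ S.card ≤ 1 / 16 := by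
    have hsplit : p * (1 / (7 * D * k) : ℝ) ^ D = p * (1 / (7 * D)) ^ D * (1 / k) ^ D := by
      rw [mul_assoc p, ← mul_pow]; congr 2; field_simp
    have hle : p * (1 / (7 * D * k) : ℝ) ^ D ≤ 1 := by
      have : (1 / (7 * D * k) : ℝ) ^ D ≤ 1 := by
        refine pow_le_one₀ (by positivity) ?_
        rw [div_le_one (by positivity)]
        have : 1 ≤ 7 * D * k := Nat.one_le_iff_ne_zero.2 (by positivity)
        exact_mod_cast this
      exact mul_le_one₀ hp1.le (by positivity) this
    have he : 4 ≤ (S.card : ℝ) * (p * (1 / (7 * D * k) : ℝ) ^ D) := by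
      rw [hS, hsplit]
      calc (4 : ℝ) ≤ a₁ * Real.log m := by
            rw [div_le_iff₀ ha₁0] at h2; linarith
        _ = m * (p * (1 / (7 * D)) ^ D * (Real.log m / (2 ^ D * (4 * m)))) := by
            rw [ha₁]; field_simp
        _ ≤ _ := by gcongr
    have hexp : Real.exp (-4) ≤ 1 / 32 := by
      rw [Real.exp_neg, one_div]
      refine inv_anti₀ (by norm_num) ?_
      have : Real.exp 4 = Real.exp 1 ^ 4 := by rw [← Real.exp_nat_mul]; norm_num
      rw [this]
      have h27 : (2.7 : ℝ) ≤ Real.exp 1 := by linarith [Real.exp_one_gt_d9]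
      calc (32 : ℝ) ≤ 2.7 ^ 4 := by norm_num
        _ ≤ _ := by gcongr
    have := (one_sub_pow_le_exp hle S.card).trans
      ((Real.exp_le_exp.2 (neg_le_neg he)).trans hexp)
    linarith
  have hcore : (1 - p * (1 / (3 * k) : ℝ) ^ D) ^ (Sᶜ.card - 1) ≤ 1 / 2 := by
    have hsplit : p * (1 / (3 * k) : ℝ) ^ D = p * (1 / 3) ^ D * (1 / k) ^ D := by
      rw [mul_assoc p, ← mul_pow]; congr 2; field_simp
    have hle : p * (1 / (3 * k) : ℝ) ^ D ≤ 1 := by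
      have : (1 / (3 * k) : ℝ) ^ D ≤ 1 := by
        refine pow_le_one₀ (by positivity) ?_
        rw [div_le_one (by positivity)]
        have : 1 ≤ 3 * k := by omega
        exact_mod_cast this
      exact mul_le_one₀ hp1.le (by positivity) this
    have he : 1 ≤ ((Sᶜ.card - 1 : ℕ) : ℝ) * (p * (1 / (3 * k) : ℝ) ^ D) := by
      rw [hsplit]
      calc (1 : ℝ) ≤ a₂ * Real.log m := by
            rw [div_le_iff₀ ha₂0] at h3; linarith
        _ = ((1 - θ) / 2 * m) * (p * (1 / 3) ^ D * (Real.log m / (2 ^ D * (4 * m)))) := by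
            rw [ha₂]; field_simp
        _ ≤ _ := by gcongr
    have hexp : Real.exp (-1) ≤ 1 / 2 := by
      rw [Real.exp_neg, one_div]
      refine inv_anti₀ (by norm_num) ?_
      linarith [Real.exp_one_gt_d9]
    exact (one_sub_pow_le_exp hle _).trans ((Real.exp_le_exp.2 (neg_le_neg he)).trans hexp)
  have hsum := hbound.trans ((add_le_add hempty hface).trans_eq (by norm_num : _ = (1 / 8 : ℝ)))
  refine le_trans (measureReal_mono ?_) hsum
  intro x hx hx'
  refine hx (le_trans ?_ hx')
  have hn0 : (0 : ℝ) ≤ n := Nat.cast_nonneg n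
  have hr0 := rate_nonneg D m
  have key : c * (1 - θ) / (224 * D) * rate D m * n ≤
      Sᶜ.card * (c * (1 / (14 * D * k)) *
        (1 - (1 - p * (1 / (3 * k)) ^ D) ^ (Sᶜ.card - 1))) := by
    calc c * (1 - θ) / (224 * D) * rate D m * n
        = ((1 - θ) * n) * (c * (1 / (14 * D) * (rate D m / 8)) * (1 / 2)) := by
          field_simp; ring
      _ ≤ Sᶜ.card * (c * (1 / (14 * D) * (1 / k)) *
          (1 - (1 - p * (1 / (3 * k)) ^ D) ^ (Sᶜ.card - 1))) := by
          gcongr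
          linarith
      _ = _ := by
          rw [show (1 / (14 * D * k) : ℝ) = 1 / (14 * D) * (1 / k) by field_simp]
  linarith

end Asymptotics

/-! ### The two concrete mixtures and the final bounds -/

section Mixture

variable {D : ℕ}

theorem labelledLaw_prod_true (p : ℝ) (Pp Pm : Measure (Pt D)) {A : Set (Pt D)}
    (hA : MeasurableSet A) :
    labelledLaw p Pp Pm (A ×ˢ {true}) = ENNReal.ofReal p * Pp A := by
  have hm : MeasurableSet (A ×ˢ ({true} : Set Bool)) := hA.prod (measurableSet_singleton _)
  rw [labelledLaw, Measure.add_apply, Measure.smul_apply, Measure.smul_apply,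
    Measure.map_apply measurable_prodMk_right hm, Measure.map_apply measurable_prodMk_right hm]
  simp

theorem labelledLaw_prod_false (p : ℝ) (Pp Pm : Measure (Pt D)) {A : Set (Pt D)}
    (hA : MeasurableSet A) :
    labelledLaw p Pp Pm (A ×ˢ {false}) = ENNReal.ofReal (1 - p) * Pm A := by
  have hm : MeasurableSet (A ×ˢ ({false} : Set Bool)) := hA.prod (measurableSet_singleton _)
  rw [labelledLaw, Measure.add_apply, Measure.smul_apply, Measure.smul_apply,
    Measure.map_apply measurable_prodMk_right hm, Measure.map_apply measurable_prodMk_right hm]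
  simp

theorem labelledLaw_prod_univ (p : ℝ) (Pp Pm : Measure (Pt D)) {A : Set (Pt D)}
    (hA : MeasurableSet A) :
    labelledLaw p Pp Pm (A ×ˢ Set.univ) =
      ENNReal.ofReal p * Pp A + ENNReal.ofReal (1 - p) * Pm A := by
  have hm : MeasurableSet (A ×ˢ (Set.univ : Set Bool)) := hA.prod MeasurableSet.univ
  rw [labelledLaw, Measure.add_apply, Measure.smul_apply, Measure.smul_apply,
    Measure.map_apply measurable_prodMk_right hm, Measure.map_apply measurable_prodMk_right hm]
  simp

theorem isProbabilityMeasure_labelledLaw {p : ℝ} (hp0 : 0 ≤ p) (hp1 : p ≤ 1)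
    (Pp Pm : Measure (Pt D)) [IsProbabilityMeasure Pp] [IsProbabilityMeasure Pm] :
    IsProbabilityMeasure (labelledLaw p Pp Pm) := by
  constructor
  rw [← Set.univ_prod_univ, labelledLaw_prod_univ p Pp Pm MeasurableSet.univ, measure_univ,
    measure_univ, mul_one, mul_one, ← ENNReal.ofReal_add hp0 (by linarith)]
  simp

theorem cube_zero_one_subset : cube D 0 1 ⊆ cube D (-1) 2 := fun x hx i =>
  ⟨by linarith [(hx i).1], by linarith [(hx i).2]⟩

theorem volume_unitCube : volume (cube D 0 1) = 1 := by simp [volume_cube]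

theorem volume_tripleCube : volume (cube D (-1) 2) = 3 ^ D := by
  rw [volume_cube]
  norm_num

/-- Ensures that the negative density never exceeds `1`, the positive density on the unit cube. -/
theorem one_le_volume_cube_diff (hD : 1 ≤ D) : 1 ≤ volume (cube D (-1) 2 \ cube D 0 1) := by
  rw [measure_sdiff cube_zero_one_subset (measurableSet_cube 0 1).nullMeasurableSet
    (by simp [volume_unitCube]), volume_unitCube, volume_tripleCube]
  have h3 : (3 : ℝ≥0∞) ≤ 3 ^ D := by
    calc (3 : ℝ≥0∞) = 3 ^ 1 := (pow_one _).symm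
      _ ≤ 3 ^ D := pow_le_pow_right₀ (by norm_num) hD
  refine ENNReal.le_sub_of_add_le_right (by simp) (le_trans ?_ h3)
  norm_num

/-- The negative distributions considered here: uniform on a set between `[-1, 2]^D \ [0, 1]^D`
and `[-1, 2]^D`. -/
structure IsAmbient (s : Set (Pt D)) : Prop where
  measurableSet : MeasurableSet s
  subset : s ⊆ cube D (-1) 2
  superset : cube D (-1) 2 \ cube D 0 1 ⊆ s

theorem isAmbient_cube : IsAmbient (cube D (-1) 2) :=
  ⟨measurableSet_cube _ _, subset_rfl, Set.sdiff_subset⟩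

theorem isAmbient_diff : IsAmbient (cube D (-1) 2 \ cube D 0 1) :=
  ⟨(measurableSet_cube _ _).diff (measurableSet_cube _ _), Set.sdiff_subset, subset_rfl⟩

variable {s : Set (Pt D)}

theorem IsAmbient.one_le_volume (hs : IsAmbient s) (hD : 1 ≤ D) : 1 ≤ volume s :=
  (one_le_volume_cube_diff hD).trans (measure_mono hs.superset)

theorem IsAmbient.volume_le (hs : IsAmbient s) : volume s ≤ 3 ^ D :=
  (measure_mono hs.subset).trans_eq volume_tripleCube

theorem IsAmbient.volume_ne_zero (hs : IsAmbient s) (hD : 1 ≤ D) : volume s ≠ 0 :=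
  (lt_of_lt_of_le one_pos (hs.one_le_volume hD)).ne'

theorem IsAmbient.volume_ne_top (hs : IsAmbient s) : volume s ≠ ∞ :=
  (hs.volume_le.trans_lt (ENNReal.pow_lt_top (by simp))).ne

theorem isProbabilityMeasure_unitCube : IsProbabilityMeasure (uniformDist (cube D 0 1)) :=
  isProbabilityMeasure_uniformDist (by simp [volume_unitCube]) (by simp [volume_unitCube])

theorem IsAmbient.assumptions (hs : IsAmbient s) (hD : 1 ≤ D) {p : ℝ} (hp0 : 0 < p)
    (hp1 : p < 1) : Assumptions p (uniformDist (cube D 0 1)) (uniformDist s) :=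
  ⟨⟨hp0, hp1, isProbabilityMeasure_unitCube,
    isProbabilityMeasure_uniformDist (hs.volume_ne_zero hD) hs.volume_ne_top⟩,
    positiveAssumption_uniformDist_unitCube hD,
    negativeAssumption_uniformDist hs.measurableSet (hs.volume_ne_zero hD) hs.volume_ne_top⟩

theorem IsAmbient.isProbabilityMeasure_labelledLaw (hs : IsAmbient s) (hD : 1 ≤ D) {p : ℝ}
    (hp0 : 0 < p) (hp1 : p < 1) :
    IsProbabilityMeasure (labelledLaw p (uniformDist (cube D 0 1)) (uniformDist s)) := by
  have := isProbabilityMeasure_unitCube (D := D)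
  have := isProbabilityMeasure_uniformDist (hs.volume_ne_zero hD) hs.volume_ne_top
  exact ActiveCovering.isProbabilityMeasure_labelledLaw hp0.le hp1.le _ _

theorem measureReal_labelledLaw_true {p : ℝ} (hp0 : 0 ≤ p) (Pm : Measure (Pt D)) {A : Set (Pt D)}
    (hA : A ⊆ cube D 0 1) (hAm : MeasurableSet A) :
    (labelledLaw p (uniformDist (cube D 0 1)) Pm).real (A ×ˢ {true}) = p * volume.real A := by
  rw [measureReal_def, labelledLaw_prod_true p _ _ hAm, uniformDist_unitCube_apply,
    Set.inter_eq_self_of_subset_right hA, ENNReal.toReal_mul, ENNReal.toReal_ofReal hp0,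
    measureReal_def]

/-- Outside the unit cube the negative density is at least `3 ^ (-D)`, because `s` fits into the
large cube. -/
theorem IsAmbient.le_measureReal_labelledLaw (hs : IsAmbient s) (hD : 1 ≤ D) {p : ℝ}
    (hp0 : 0 < p) (hp1 : p < 1) {A : Set (Pt D)} (hA : A ⊆ cube D (-1) 2 \ cube D 0 1)
    (hAm : MeasurableSet A) :
    (1 - p) / 3 ^ D * volume.real A ≤
      (labelledLaw p (uniformDist (cube D 0 1)) (uniformDist s)).real (A ×ˢ Set.univ) := by
  have := hs.isProbabilityMeasure_labelledLaw hD hp0 hp1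
  have hreal : volume.real s ≤ 3 ^ D := by
    have := ENNReal.toReal_mono (ENNReal.pow_ne_top (by simp)) hs.volume_le
    simpa [measureReal_def] using this
  have hreal0 : 0 < volume.real s := ENNReal.toReal_pos (hs.volume_ne_zero hD) hs.volume_ne_top
  have h1p : 0 < 1 - p := by linarith
  have hle : ENNReal.ofReal (1 - p) * uniformDist s A ≤
      labelledLaw p (uniformDist (cube D 0 1)) (uniformDist s) (A ×ˢ Set.univ) := by
    rw [labelledLaw_prod_univ p _ _ hAm]
    exact le_add_self
  refine le_trans ?_ (ENNReal.toReal_mono (measure_ne_top _ _) hle)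
  rw [uniformDist_apply hs.measurableSet, Set.inter_eq_self_of_subset_right (hA.trans hs.superset),
    ENNReal.toReal_mul, ENNReal.toReal_mul, ENNReal.toReal_ofReal h1p.le, ENNReal.toReal_inv,
    ← measureReal_def, ← measureReal_def, ← mul_assoc, ← div_eq_mul_inv]
  gcongr

/-- On the unit cube the densities are at most `1` and exactly `1`, so the odds of a negative label
are at most `(1 - p) / p`. -/
theorem IsAmbient.labelledLaw_false_le (hs : IsAmbient s) (hD : 1 ≤ D) {p : ℝ} (hp0 : 0 < p)
    {F : Set (Pt D)} (hF : MeasurableSet F) :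
    labelledLaw p (uniformDist (cube D 0 1)) (uniformDist s) ((F ∩ cube D 0 1) ×ˢ {false}) ≤
      ((1 - p) / p).toNNReal *
        labelledLaw p (uniformDist (cube D 0 1)) (uniformDist s) (F ×ˢ {true}) := by
  rw [labelledLaw_prod_true p _ _ hF, labelledLaw_prod_false p _ _ (hF.inter
    (measurableSet_cube 0 1)), uniformDist_unitCube_apply, uniformDist_apply hs.measurableSet,
    ← mul_assoc, ← mul_assoc]
  have e : (((1 - p) / p).toNNReal : ℝ≥0∞) * ENNReal.ofReal p = ENNReal.ofReal (1 - p) := by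
    change ENNReal.ofReal ((1 - p) / p) * _ = _
    rw [← ENNReal.ofReal_mul' hp0.le, div_mul_cancel₀ _ hp0.ne']
  rw [e]
  refine mul_le_mul' ?_ (measure_mono ?_)
  · calc ENNReal.ofReal (1 - p) * (volume s)⁻¹ ≤ ENNReal.ofReal (1 - p) * 1 := by
          gcongr
          exact ENNReal.inv_le_one.2 (hs.one_le_volume hD)
      _ = _ := mul_one _
  · exact fun x hx => ⟨hx.2.2, hx.2.1⟩

theorem labelledLaw_diff_false_eq_zero (p : ℝ) {F : Set (Pt D)} (hF : MeasurableSet F) :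
    labelledLaw p (uniformDist (cube D 0 1)) (uniformDist (cube D (-1) 2 \ cube D 0 1))
      ((F ∩ cube D 0 1) ×ˢ {false}) = 0 := by
  rw [labelledLaw_prod_false p _ _ (hF.inter (measurableSet_cube 0 1)),
    uniformDist_apply isAmbient_diff.measurableSet]
  have : cube D (-1) 2 \ cube D 0 1 ∩ (F ∩ cube D 0 1) = ∅ := by
    ext x
    simp only [Set.mem_inter_iff, Set.mem_sdiff, Set.mem_empty_iff_false, iff_false]
    tauto
  simp [this]

theorem measureReal_labelledLaw_diff_compl (hD : 1 ≤ D) {p : ℝ} (hp1 : p < 1) :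
    (labelledLaw p (uniformDist (cube D 0 1)) (uniformDist (cube D (-1) 2 \ cube D 0 1))).real
      ((cube D 0 1)ᶜ ×ˢ Set.univ) = 1 - p := by
  have h1 : uniformDist (cube D 0 1) (cube D 0 1)ᶜ = 0 := by
    rw [uniformDist_unitCube_apply, Set.inter_compl_self, measure_empty]
  have h2 : uniformDist (cube D (-1) 2 \ cube D 0 1) (cube D 0 1)ᶜ = 1 := by
    rw [uniformDist_apply isAmbient_diff.measurableSet,
      Set.inter_eq_self_of_subset_left (fun x hx => hx.2),
      ENNReal.inv_mul_cancel (isAmbient_diff.volume_ne_zero hD) isAmbient_diff.volume_ne_top]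
  rw [measureReal_def, labelledLaw_prod_univ p _ _ (measurableSet_cube 0 1).compl, h1, h2]
  simp [hp1.le]

theorem le_measureReal_of_sub_le {Ω : Type*} [MeasurableSpace Ω] (P : Measure Ω)
    [IsProbabilityMeasure P] {G B A : Set Ω} {a b : ℝ} (hG : a ≤ P.real G) (hB : P.real B ≤ b)
    (h : ∀ x ∈ G, x ∉ B → x ∈ A) : a - b ≤ P.real A := by
  have h1 : P.real G ≤ P.real (A ∪ B) := measureReal_mono fun x hx => by
    by_cases hxB : x ∈ B
    · exact Or.inr hxB
    · exact Or.inl (h x hx hxB)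
  have h2 := measureReal_union_le (μ := P) A B
  linarith

/-- The labels are almost surely determined by the cube, so the initial term is binomial and there
is no loss `κ`. The probability is `3/8 - 1/8`. -/
theorem exists_lowerBoundHolds_diff (hD : 1 ≤ D) {p : ℝ} (hp0 : 0 < p) (hp1 : p < 1) {θ : ℝ}
    (hθ : θ < 1) :
    ∃ C : ℝ, 0 < C ∧ ∃ N : ℕ, ∀ n m : ℕ, N ≤ n → N ≤ m → (m : ℝ) ≤ θ * n →
      LowerBoundHolds p (uniformDist (cube D 0 1)) (uniformDist (cube D (-1) 2 \ cube D 0 1))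
        C n m := by
  classical
  have hs := isAmbient_diff (D := D)
  have hprob := hs.isProbabilityMeasure_labelledLaw hD hp0 hp1
  obtain ⟨C, hC, N₁, h₁⟩ := exists_forall_measureReal_excessCost_lt_le hD
    (labelledLaw p (uniformDist (cube D 0 1)) (uniformDist (cube D (-1) 2 \ cube D 0 1)))
    (c := (1 - p) / 3 ^ D) (κ := 0) hp0 hp1 (div_pos (by linarith) (by positivity))
    (fun A hA hAm => measureReal_labelledLaw_true hp0.le _ hA hAm)
    (fun A hA hAm => hs.le_measureReal_labelledLaw hD hp0 hp1 hA hAm)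
    (fun F hF => by rw [labelledLaw_diff_false_eq_zero p hF]; exact zero_le) hθ
  have hq := measureReal_labelledLaw_diff_compl hD hp1
  obtain ⟨N₂, h₂⟩ := exists_forall_le_measureReal_card_filter
    (labelledLaw p (uniformDist (cube D 0 1)) (uniformDist (cube D (-1) 2 \ cube D 0 1)))
    (A := (cube D 0 1)ᶜ ×ˢ Set.univ) ((measurableSet_cube 0 1).compl.prod MeasurableSet.univ)
    (by rw [hq]; linarith) (by rw [hq]; linarith)
  refine ⟨C, hC, max N₁ N₂, fun n m _ hm hmn => ?_⟩
  have hmn' : m ≤ n := by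
    have : (m : ℝ) ≤ n := hmn.trans (by nlinarith [Nat.cast_nonneg (α := ℝ) n])
    exact_mod_cast this
  refine le_measureReal_outcomeLaw p _ _ hmn' (measurable_excessCost _) (abs_excessCost_le _)
    fun S hS => ?_
  have h₂' := h₂ n m ((le_max_right _ _).trans hm) S hS
  have h₁' := h₁ n m ((le_max_left _ _).trans hm) hmn S hS
  refine le_trans (by norm_num) (le_measureReal_of_sub_le _ h₂' h₁' fun x hx hx' => ?_)
  simp only [Set.mem_ofPred_eq, not_not] at hx hx' ⊢
  refine le_trans ?_ hx'
  rw [hq] at hx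
  simp only [Set.mem_prod, Set.mem_compl_iff, Set.mem_univ, and_true] at hx
  simp only [NNReal.coe_zero, sub_zero]
  linarith

/-- The initial term is simply dropped: its target `(1 - p) m` is of no larger order than the shell
term, so no fluctuation argument is needed. -/
theorem exists_lowerBoundHolds_cube (hD : 1 ≤ D) {p : ℝ} (hp0 : 0 < p) (hp1 : p < 1) :
    ∃ C : ℝ, 0 < C ∧ ∃ c : ℝ, 0 < c ∧ ∃ N : ℕ, ∀ n m : ℕ, N ≤ n → N ≤ m → m ≤ n →
      (m : ℝ) ≤ c * rate D m * n →
      LowerBoundHolds p (uniformDist (cube D 0 1)) (uniformDist (cube D (-1) 2)) C n m := by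
  classical
  have hs := isAmbient_cube (D := D)
  have hprob := hs.isProbabilityMeasure_labelledLaw hD hp0 hp1
  obtain ⟨C, hC, N, h₁⟩ := exists_forall_measureReal_excessCost_lt_le hD
    (labelledLaw p (uniformDist (cube D 0 1)) (uniformDist (cube D (-1) 2)))
    (c := (1 - p) / 3 ^ D) hp0 hp1 (div_pos (by linarith) (by positivity))
    (fun A hA hAm => measureReal_labelledLaw_true hp0.le _ hA hAm)
    (fun A hA hAm => hs.le_measureReal_labelledLaw hD hp0 hp1 hA hAm)
    (fun F hF => hs.labelledLaw_false_le hD hp0 hF) (θ := 1 / 2) (by norm_num)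
  set κ := ((1 - p) / p).toNNReal
  -- Both `(1 - p) m` and `κ ≤ m` are at most a quarter of `C * rate D m * n`, which leaves room for
  -- the claimed quarter. The bound `1 / 2` with `rate D m ≤ 1` gives `m ≤ n / 2`, the case `θ = 1 /
  -- 2`.
  refine ⟨C / 4, by positivity, min (C / 4) (1 / 2), by positivity, max (max N 1) ⌈(κ : ℝ)⌉₊,
    fun n m _ hm hmn hmr => ?_⟩
  have hm1 : 1 ≤ m := ((le_max_right _ _).trans (le_max_left _ _)).trans hm
  have hmκ : (κ : ℝ) ≤ m := (Nat.le_ceil _).trans (by exact_mod_cast (le_max_right _ _).trans hm)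
  have hrn : 0 ≤ rate D m * n := mul_nonneg (rate_nonneg D m) (Nat.cast_nonneg n)
  have hrn1 : rate D m * n ≤ n :=
    mul_le_of_le_one_left (Nat.cast_nonneg n) (rate_le_one D hm1)
  rw [mul_assoc] at hmr
  have hm2 : (m : ℝ) ≤ 1 / 2 * n := hmr.trans
    (mul_le_mul (min_le_right _ _) hrn1 hrn (by norm_num))
  have hm4 : (m : ℝ) ≤ C / 4 * (rate D m * n) := hmr.trans
    (mul_le_mul_of_nonneg_right (min_le_left _ _) hrn)
  refine le_measureReal_outcomeLaw p _ _ hmn (measurable_excessCost _) (abs_excessCost_le _)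
    fun S hS => ?_
  have h₁' := h₁ n m (((le_max_left _ _).trans (le_max_left _ _)).trans hm) hm2 S hS
  refine le_trans (by norm_num) (le_measureReal_of_sub_le _ (G := Set.univ) (a := 1)
    (by simp) h₁' fun x _ hx' => ?_)
  simp only [Set.mem_ofPred_eq, not_not] at hx' ⊢
  refine le_trans ?_ hx'
  have hcard : (0 : ℝ) ≤ (S.filter fun i => (x i).1 ∉ cube D 0 1).card := Nat.cast_nonneg _
  have hpm : (1 - p) * m ≤ m := by nlinarith [Nat.cast_nonneg (α := ℝ) m]
  nlinarith

end Mixture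

end ActiveCovering

theorem theorem3 (D : ℕ) (hD : 1 ≤ D) (p : ℝ) (hp0 : 0 < p) (hp1 : p < 1) :
    -- existence of a distribution with the bound for all initial sample sizes up to `θ n`
    (∃ Pp Pm : MeasureTheory.Measure (ActiveCovering.Pt D),
      ActiveCovering.Assumptions p Pp Pm ∧
      ∀ θ : ℝ, θ < 1 → ∃ C : ℝ, 0 < C ∧ ∃ N : ℕ, ∀ n m : ℕ, N ≤ n → N ≤ m → (m : ℝ) ≤ θ * n →
        ActiveCovering.LowerBoundHolds p Pp Pm C n m) ∧
    -- the uniform distributions on `[0,1]^D` and `[-1,2]^D`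
    (ActiveCovering.Assumptions p
        (ActiveCovering.uniformDist (ActiveCovering.cube D 0 1))
        (ActiveCovering.uniformDist (ActiveCovering.cube D (-1) 2)) ∧
      ∃ C : ℝ, 0 < C ∧ ∃ c : ℝ, 0 < c ∧ ∃ N : ℕ, ∀ n m : ℕ, N ≤ n → N ≤ m → m ≤ n →
        (m : ℝ) ≤ c * ActiveCovering.rate D m * n →
        ActiveCovering.LowerBoundHolds p
          (ActiveCovering.uniformDist (ActiveCovering.cube D 0 1))
          (ActiveCovering.uniformDist (ActiveCovering.cube D (-1) 2)) C n m) :=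
  ⟨⟨_, _, ActiveCovering.isAmbient_diff.assumptions hD hp0 hp1,
    fun _ hθ => ActiveCovering.exists_lowerBoundHolds_diff hD hp0 hp1 hθ⟩,
    ActiveCovering.isAmbient_cube.assumptions hD hp0 hp1,
    ActiveCovering.exists_lowerBoundHolds_cube hD hp0 hp1⟩
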